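/- Let $\mathfrak h$ be a separable complex Hilbert space and let $\mathfrak X$ be the real Banach space of self-adjoint trace class operators on $\mathfrak h$ with the trace norm $\|\varrho\|=\mathrm{Trace}\,|\varrho|$, ordered by the cone $\mathfrak X_+$ of positive operators. Let $\Psi(\varrho)=\mathrm{Trace}\,\varrho$ be the positive functional that coincides with the norm on $\mathfrak X_+$. A $C_0$-semigroup $(T(t))_{t\ge 0}$ of bounded linear operators on $\mathfrak X$ is called substochastic if $T(t)u\in\mathfrak X_+$ and $\|T(t)u\|\le\|u\|$ for all $u\in\mathfrak X_+$ and $t\ge 0$. Let $\mathcal A$ be the generator of a substochastic $C_0$-semigroup on $\mathfrak X$, and let $\mathcal B:\mathscr D(\mathcal A)\to\mathfrak X$ be a linear operator with $\mathcal B u\in\mathfrak X_+$ and $\langle\Psi,\mathcal A u+\mathcal B u\rangle\le 0$ for all $u\in\mathscr D(\mathcal A)\cap\mathfrak X_+$. Let $(\mathcal V(t))_{t\ge 0}$ be the smallest substochastic $C_0$-semigroup whose generator is an extension of $(\mathcal A+\mathcal B,\mathscr D(\mathcal A))$ (it exists by Kato's generation theorem), and let $\mathcal G$ be its generator. For $\lambda>0$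 define the functional $\Xi_\lambda$ on $\mathfrak X$ by $$\langle\Xi_\lambda,u\rangle=\mathfrak a_0\big((\lambda-\mathcal G)^{-1}u\big)-\overline{\mathfrak a}\big((\lambda-\mathcal G)^{-1}u\big),$$ where $\mathfrak a_0(v)=-\langle\Psi,\mathcal G v\rangle$ for $v\in\mathscr D(\mathcal G)$ and, with $\mathfrak a(v)=-\langle\Psi,\mathcal A v+\mathcal B v\rangle$ for $v\in\mathscr D(\mathcal A)$, $$\overline{\mathfrak a}\big((\lambda-\mathcal G)^{-1}u\big)=\sum_{n=0}^\infty\mathfrak a\big((\lambda-\mathcal A)^{-1}[\mathcal B(\lambda-\mathcal A)^{-1}]^n u\big).$$ Let $\mathcal H=\{u\in\mathfrak X_+ : \langle\Xi_\lambda,u\rangle=0\text{ for all }\lambda>0\}$. **Theorem.** For every $\lambda>0$ there is a positive bounded self-adjoint operator $\beta_\lambda$ on $\mathfrak h$ with $\langle\Xi_\lambda,\varrho\rangle=\mathrm{Trace}[\beta_\lambda\varrho]$ for all $\varrho\in\mathfrak X_+$. For every such family $(\beta_\lambda)_{\lambda>0}$, the null space $\mathrm{Null}(\beta_\lambda)$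 is independent of $\lambda>0$. If $\mathbf P$ is the orthogonal projection of $\mathfrak h$ onto $\mathrm{Null}(\beta_\lambda)$ and $\mathbf Q=\mathbf{Id}_{\mathfrak h}-\mathbf P$, then $$\mathcal H=\{\varrho\in\mathfrak X_+ : \varrho=\mathbf P\varrho=\varrho\mathbf P\}=\{\varrho\in\mathfrak X_+ : \mathbf Q\varrho=\varrho\mathbf Q=0\}$$ and $$\mathcal H-\mathcal H=\{\varrho\in\mathfrak X : \varrho=\mathbf P\varrho=\varrho\mathbf P\}.$$ -/

import Mathlib

open Filter Topology
open scoped ENNReal Pointwise InnerProductSpace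

set_option linter.unusedSectionVars false

namespace Honesty

/-! ### Self-adjoint trace class operators -/

section TraceClass

variable {𝔥 : Type*} [NormedAddCommGroup 𝔥] [InnerProductSpace ℂ 𝔥] [CompleteSpace 𝔥]

/-- The index set of a fixed orthonormal (Hilbert) basis of `𝔥`. -/
noncomputable def basisSet (𝔥 : Type*) [NormedAddCommGroup 𝔥] [InnerProductSpace ℂ 𝔥]
    [CompleteSpace 𝔥] : Set 𝔥 :=
  (exists_hilbertBasis ℂ 𝔥).choose

/-- A fixed orthonormal (Hilbert) basis of `𝔥`. -/
noncomputable def basis (𝔥 : Type*) [NormedAddCommGroup 𝔥] [InnerProductSpace ℂ 𝔥]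
    [CompleteSpace 𝔥] : HilbertBasis (basisSet 𝔥) ℂ 𝔥 :=
  (exists_hilbertBasis ℂ 𝔥).choose_spec.choose

/-- The trace `∑ᵢ ⟨eᵢ, T eᵢ⟩ ∈ [0, ∞]` of a positive bounded operator `T`
(see `posTrace_eq` for the independence of the basis). -/
noncomputable def posTrace (T : 𝔥 →L[ℂ] 𝔥) : ℝ≥0∞ :=
  ∑' i, ENNReal.ofReal (⟪basis 𝔥 i, T (basis 𝔥 i)⟫_ℂ).re

/-- A bounded operator is of trace class if `Trace |T| < ∞`, where `|T| = (T* T)^{1/2}`. -/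
def IsTraceClass (T : 𝔥 →L[ℂ] 𝔥) : Prop :=
  posTrace (CFC.abs T) ≠ ∞

/-- The trace `∑ᵢ ⟨eᵢ, T eᵢ⟩` (absolutely convergent and independent of the basis for operators
of trace class, the only ones it is used for). -/
noncomputable def trace (T : 𝔥 →L[ℂ] 𝔥) : ℂ :=
  ∑' i, ⟪basis 𝔥 i, T (basis 𝔥 i)⟫_ℂ

theorem parseval {ι : Type*} (b : HilbertBasis ι ℂ 𝔥) (x : 𝔥) :
    ∑' i, ENNReal.ofReal (‖⟪b i, x⟫_ℂ‖ ^ 2) = ENNReal.ofReal (‖x‖ ^ 2) := by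
  have h := b.hasSum_inner_mul_inner x x
  have h2 : HasSum (fun i => ‖⟪b i, x⟫_ℂ‖ ^ 2) (‖x‖ ^ 2) := by
    have h3 := Complex.hasSum_re h
    convert h3 using 1
    · funext i
      rw [← inner_conj_symm x (b i), RCLike.conj_mul]
      norm_cast
    · rw [inner_self_eq_norm_sq_to_K]
      norm_cast
  rw [← ENNReal.ofReal_tsum_of_nonneg (fun i => by positivity) h2.summable, h2.tsum_eq]

theorem sum_swap {ι κ : Type*} (b : HilbertBasis ι ℂ 𝔥) (c : HilbertBasis κ ℂ 𝔥)
    {T : 𝔥 →L[ℂ] 𝔥} (hT : 0 ≤ T) :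
    ∑' i, ENNReal.ofReal (⟪b i, T (b i)⟫_ℂ).re = ∑' j, ENNReal.ofReal (⟪c j, T (c j)⟫_ℂ).re := by
  set S : 𝔥 →L[ℂ] 𝔥 := CFC.sqrt T with hS
  have hSS : S * S = T := CFC.sqrt_mul_sqrt_self T hT
  have hsa : IsSelfAdjoint S := (CFC.sqrt_nonneg T).isSelfAdjoint
  have hsym : ∀ x y, ⟪S x, y⟫_ℂ = ⟪x, S y⟫_ℂ := fun x y => hsa.isSymmetric x y
  have key : ∀ x, (⟪x, T x⟫_ℂ).re = ‖S x‖ ^ 2 := by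
    intro x
    rw [← hSS, mul_apply_eq_comp, ← hsym, inner_self_eq_norm_sq_to_K]
    norm_cast
  simp_rw [key]
  have h1 : ∀ i, ENNReal.ofReal (‖S (b i)‖ ^ 2)
      = ∑' j, ENNReal.ofReal (‖⟪c j, S (b i)⟫_ℂ‖ ^ 2) := fun i => (parseval c _).symm
  have h2 : ∀ j, ENNReal.ofReal (‖S (c j)‖ ^ 2)
      = ∑' i, ENNReal.ofReal (‖⟪b i, S (c j)⟫_ℂ‖ ^ 2) := fun j => (parseval b _).symm
  simp_rw [h1, h2]
  rw [ENNReal.tsum_comm]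
  refine tsum_congr fun j => tsum_congr fun i => ?_
  rw [← hsym, norm_inner_symm]

theorem posTrace_eq {ι : Type*} (b : HilbertBasis ι ℂ 𝔥) {T : 𝔥 →L[ℂ] 𝔥} (hT : 0 ≤ T) :
    posTrace T = ∑' i, ENNReal.ofReal (⟪b i, T (b i)⟫_ℂ).re :=
  sum_swap _ b hT

theorem re_inner_nonneg {T : 𝔥 →L[ℂ] 𝔥} (hT : 0 ≤ T) (x : 𝔥) : 0 ≤ (⟪x, T x⟫_ℂ).re :=
  ((ContinuousLinearMap.nonneg_iff_isPositive T).1 hT).re_inner_nonneg_right x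

theorem exists_adapted_basis (C : 𝔥 →L[ℂ] 𝔥) :
    ∃ (w : Set 𝔥) (b : HilbertBasis w ℂ 𝔥), ∀ i, C⁺ (b i) = 0 ∨ C⁻ (b i) = 0 := by
  obtain ⟨v, c, hc⟩ := exists_hilbertBasis ℂ (C⁺).ker
  set s : Set 𝔥 := Subtype.val '' v with hs
  have hon : Orthonormal ℂ ((↑) : s → 𝔥) := by
    have h1 : Orthonormal ℂ ((↑) : v → (C⁺).ker) := hc ▸ c.orthonormal
    have h2 : Orthonormal ℂ (fun i : v => ((i : (C⁺).ker) : 𝔥)) :=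
      h1.comp_linearIsometry (C⁺).ker.subtypeₗᵢ
    have h3 := h2.toSubtypeRange
    have h4 : Set.range (fun i : v => ((i : (C⁺).ker) : 𝔥)) = s := by
      rw [hs, Set.image_eq_range]
    rwa [h4] at h3
  obtain ⟨w, b, hsw, hb⟩ := hon.exists_hilbertBasis_extension
  refine ⟨w, b, fun i => ?_⟩
  by_cases hi : (i : 𝔥) ∈ s
  · left
    obtain ⟨y, -, hy⟩ := hi
    rw [hb, ← hy]
    exact y.2
  · right
    have horth : ∀ y : (C⁺).ker, ⟪b i, (y : 𝔥)⟫_ℂ = 0 := by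
      intro y
      have h1 := c.hasSum_repr y
      have h2 := (h1.mapL (C⁺).ker.subtypeL).mapL (innerSL ℂ (b i))
      refine h2.unique ?_ |>.trans rfl
      convert hasSum_zero with j
      have hj : ((c j : (C⁺).ker) : 𝔥) ∈ s := ⟨c j, by rw [hc]; exact j.2, rfl⟩
      have hne : (⟨_, hsw hj⟩ : w) ≠ i := fun h => hi (h ▸ hj)
      have h5 : ⟪b i, b ⟨_, hsw hj⟩⟫_ℂ = 0 := b.orthonormal.2 hne.symm
      have h6 : b ⟨_, hsw hj⟩ = ((c j : (C⁺).ker) : 𝔥) := by rw [hb]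
      rw [h6] at h5
      simp [h5]
    have hsa : IsSelfAdjoint C⁻ := (CFC.negPart_nonneg C).isSelfAdjoint
    have hmem : C⁻ (C⁻ (b i)) ∈ (C⁺).ker := by
      have := CFC.posPart_mul_negPart C
      exact congrArg (fun T : 𝔥 →L[ℂ] 𝔥 => T (C⁻ (b i))) this
    have h := horth ⟨_, hmem⟩
    have h' : ⟪C⁻ (b i), C⁻ (b i)⟫_ℂ = 0 := (hsa.isSymmetric (b i) (C⁻ (b i))).trans h
    exact inner_self_eq_zero.1 h'

theorem inner_parts {R : 𝔥 →L[ℂ] 𝔥} (hR : IsSelfAdjoint R) (x : 𝔥) :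
    (⟪x, R x⟫_ℂ).re = (⟪x, R⁺ x⟫_ℂ).re - (⟪x, R⁻ x⟫_ℂ).re ∧
    (⟪x, CFC.abs R x⟫_ℂ).re = (⟪x, R⁺ x⟫_ℂ).re + (⟪x, R⁻ x⟫_ℂ).re := by
  have h1 : R x = R⁺ x - R⁻ x :=
    congrArg (fun T : 𝔥 →L[ℂ] 𝔥 => T x) (CFC.posPart_sub_negPart R hR).symm
  have h2 : CFC.abs R x = R⁺ x + R⁻ x :=
    congrArg (fun T : 𝔥 →L[ℂ] 𝔥 => T x) (CFC.posPart_add_negPart R hR).symm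
  rw [h1, h2, inner_sub_right, inner_add_right, Complex.sub_re, Complex.add_re]
  exact ⟨rfl, rfl⟩

theorem re_inner_abs_add_le {R S T : 𝔥 →L[ℂ] 𝔥} (hR : IsSelfAdjoint R) (hS : IsSelfAdjoint S)
    (hT : IsSelfAdjoint T) (x : 𝔥) (hx : R x = S x + T x) (hb : R⁺ x = 0 ∨ R⁻ x = 0) :
    (⟪x, CFC.abs R x⟫_ℂ).re ≤ (⟪x, CFC.abs S x⟫_ℂ).re + (⟪x, CFC.abs T x⟫_ℂ).re := by
  have e3 : (⟪x, R x⟫_ℂ).re = (⟪x, S x⟫_ℂ).re + (⟪x, T x⟫_ℂ).re := by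
    rw [hx, inner_add_right, Complex.add_re]
  have hr : (⟪x, R⁺ x⟫_ℂ).re = 0 ∨ (⟪x, R⁻ x⟫_ℂ).re = 0 :=
    hb.imp (fun h => by rw [h, inner_zero_right, Complex.zero_re])
      (fun h => by rw [h, inner_zero_right, Complex.zero_re])
  have sp := re_inner_nonneg (CFC.posPart_nonneg S) x
  have sn := re_inner_nonneg (CFC.negPart_nonneg S) x
  have tp := re_inner_nonneg (CFC.posPart_nonneg T) x
  have tn := re_inner_nonneg (CFC.negPart_nonneg T) x
  rw [(inner_parts hR x).1, (inner_parts hS x).1, (inner_parts hT x).1] at e3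
  rw [(inner_parts hR x).2, (inner_parts hS x).2, (inner_parts hT x).2]
  generalize (⟪x, R⁺ x⟫_ℂ).re = rp at *
  generalize (⟪x, R⁻ x⟫_ℂ).re = rn at *
  generalize (⟪x, S⁺ x⟫_ℂ).re = a at *
  generalize (⟪x, S⁻ x⟫_ℂ).re = b at *
  generalize (⟪x, T⁺ x⟫_ℂ).re = c at *
  generalize (⟪x, T⁻ x⟫_ℂ).re = d at *
  rcases hr with h | h <;> linarith

theorem posTrace_abs_add_le {S T : 𝔥 →L[ℂ] 𝔥} (hS : IsSelfAdjoint S) (hT : IsSelfAdjoint T) :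
    posTrace (CFC.abs (S + T)) ≤ posTrace (CFC.abs S) + posTrace (CFC.abs T) := by
  obtain ⟨R, hR⟩ : ∃ R, R = S + T := ⟨_, rfl⟩
  have hRsa : IsSelfAdjoint R := hR ▸ hS.add hT
  rw [← hR]
  obtain ⟨w, b, hb⟩ := exists_adapted_basis R
  rw [posTrace_eq b (CFC.abs_nonneg R), posTrace_eq b (CFC.abs_nonneg S),
    posTrace_eq b (CFC.abs_nonneg T), ← ENNReal.tsum_add]
  refine ENNReal.tsum_le_tsum fun i => ?_
  rw [← ENNReal.ofReal_add (re_inner_nonneg (CFC.abs_nonneg S) _)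
    (re_inner_nonneg (CFC.abs_nonneg T) _)]
  exact ENNReal.ofReal_le_ofReal
    (re_inner_abs_add_le hRsa hS hT (b i) (by rw [hR, add_apply]) (hb i))

theorem posTrace_abs_smul (c : ℝ) (T : 𝔥 →L[ℂ] 𝔥) :
    posTrace (CFC.abs (c • T)) = ENNReal.ofReal |c| * posTrace (CFC.abs T) := by
  rw [CFC.abs_smul, posTrace, posTrace, ← ENNReal.tsum_mul_left]
  refine tsum_congr fun i => ?_
  rw [← ENNReal.ofReal_mul (abs_nonneg c)]
  congr 1
  have h : ((‖c‖ • CFC.abs T) (basis 𝔥 i)) = ((‖c‖ : ℝ) : ℂ) • (CFC.abs T (basis 𝔥 i)) := by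
    simp
  rw [h, inner_smul_right, Complex.re_ofReal_mul, Real.norm_eq_abs]

theorem eq_zero_of_posTrace_abs {T : 𝔥 →L[ℂ] 𝔥} (h : posTrace (CFC.abs T) = 0) : T = 0 := by
  rw [posTrace, ENNReal.tsum_eq_zero] at h
  set S : 𝔥 →L[ℂ] 𝔥 := CFC.sqrt (CFC.abs T) with hS
  have hSS : S * S = CFC.abs T := CFC.sqrt_mul_sqrt_self _ (CFC.abs_nonneg T)
  have hsa : IsSelfAdjoint S := (CFC.sqrt_nonneg (CFC.abs T)).isSelfAdjoint
  have h0 : ∀ i, CFC.abs T (basis 𝔥 i) = 0 := by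
    intro i
    have h1 := ENNReal.ofReal_eq_zero.1 (h i)
    have h2 : (⟪S (basis 𝔥 i), S (basis 𝔥 i)⟫_ℂ).re ≤ 0 := by
      rw [← hSS, mul_apply_eq_comp] at h1
      exact (congrArg Complex.re (hsa.isSymmetric (basis 𝔥 i) (S (basis 𝔥 i)))).trans_le h1
    have h3 : S (basis 𝔥 i) = 0 := by
      rw [inner_self_eq_norm_sq_to_K] at h2
      have h4 : ‖S (basis 𝔥 i)‖ ^ 2 ≤ 0 := by exact_mod_cast h2
      exact norm_eq_zero.1 (pow_eq_zero_iff two_ne_zero |>.1 (le_antisymm h4 (sq_nonneg _)))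
    rw [← hSS, mul_apply_eq_comp, h3, map_zero]
  have habs : CFC.abs T = 0 := by
    ext x
    have hx := ((basis 𝔥).hasSum_repr x).mapL (CFC.abs T)
    have hz : HasSum (fun i => CFC.abs T ((basis 𝔥).repr x i • basis 𝔥 i)) 0 := by
      convert hasSum_zero with i
      rw [map_smul, h0 i, smul_zero]
    exact hx.unique hz
  exact CFC.abs_eq_zero_iff.1 habs

/-- The real vector space of self-adjoint trace class operators, as a subspace. -/
noncomputable def saTraceClass (𝔥 : Type*) [NormedAddCommGroup 𝔥] [InnerProductSpace ℂ 𝔥]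
    [CompleteSpace 𝔥] : Submodule ℝ (𝔥 →L[ℂ] 𝔥) where
  carrier := {T | IsSelfAdjoint T ∧ IsTraceClass T}
  zero_mem' := ⟨IsSelfAdjoint.zero _, by simp [IsTraceClass, posTrace]⟩
  add_mem' := fun {S T} hS hT => ⟨hS.1.add hT.1,
    ((posTrace_abs_add_le hS.1 hT.1).trans_lt (ENNReal.add_lt_top.2
      ⟨hS.2.lt_top, hT.2.lt_top⟩)).ne⟩
  smul_mem' := fun c T hT => ⟨(IsSelfAdjoint.all c).smul hT.1, by
    rw [IsTraceClass, posTrace_abs_smul]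
    exact ENNReal.mul_ne_top ENNReal.ofReal_ne_top hT.2⟩

/-- The space of self-adjoint trace class operators on `𝔥`; it carries the trace norm below
(and not the operator norm). -/
def TraceClassSA (𝔥 : Type*) [NormedAddCommGroup 𝔥] [InnerProductSpace ℂ 𝔥]
    [CompleteSpace 𝔥] : Type _ :=
  saTraceClass 𝔥

namespace TraceClassSA

noncomputable instance : AddCommGroup (TraceClassSA 𝔥) :=
  inferInstanceAs (AddCommGroup (saTraceClass 𝔥))

noncomputable instance : Module ℝ (TraceClassSA 𝔥) :=
  inferInstanceAs (Module ℝ (saTraceClass 𝔥))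

/-- The underlying bounded operator. -/
def op (ϱ : TraceClassSA 𝔥) : 𝔥 →L[ℂ] 𝔥 := ϱ.1

/-- The trace norm `‖ϱ‖ = Trace |ϱ|`. -/
noncomputable instance : Norm (TraceClassSA 𝔥) := ⟨fun ϱ => (posTrace (CFC.abs ϱ.op)).toReal⟩

theorem normCore : NormedSpace.Core ℝ (TraceClassSA 𝔥) where
  norm_nonneg _ := ENNReal.toReal_nonneg
  norm_smul c ϱ := by
    change (posTrace (CFC.abs (c • ϱ.op))).toReal = ‖c‖ * (posTrace (CFC.abs ϱ.op)).toReal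
    rw [posTrace_abs_smul, ENNReal.toReal_mul, ENNReal.toReal_ofReal (abs_nonneg c),
      Real.norm_eq_abs]
  norm_triangle ϱ σ := by
    change (posTrace (CFC.abs (ϱ.op + σ.op))).toReal
      ≤ (posTrace (CFC.abs ϱ.op)).toReal + (posTrace (CFC.abs σ.op)).toReal
    refine le_of_le_of_eq ?_ (ENNReal.toReal_add ϱ.2.2 σ.2.2)
    exact ENNReal.toReal_mono (ENNReal.add_ne_top.2 ⟨ϱ.2.2, σ.2.2⟩)
      (posTrace_abs_add_le ϱ.2.1 σ.2.1)
  norm_eq_zero_iff ϱ := by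
    constructor
    · intro h
      have h' : (posTrace (CFC.abs ϱ.op)).toReal = 0 := h
      rcases (ENNReal.toReal_eq_zero_iff _).1 h' with h1 | h1
      · exact Subtype.ext (eq_zero_of_posTrace_abs h1)
      · exact absurd h1 ϱ.2.2
    · rintro rfl
      change (posTrace (CFC.abs (0 : 𝔥 →L[ℂ] 𝔥))).toReal = 0
      simp [posTrace]

noncomputable instance : NormedAddCommGroup (TraceClassSA 𝔥) := NormedAddCommGroup.ofCore normCore

noncomputable instance : NormedSpace ℝ (TraceClassSA 𝔥) := NormedSpace.ofCore normCore

/-- `ϱ ≤ σ` if and only if `σ - ϱ` is a positive operator. -/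
noncomputable instance : PartialOrder (TraceClassSA 𝔥) :=
  PartialOrder.lift op Subtype.val_injective

/-- The positive functional `Ψ` on the self-adjoint trace class operators that coincides with the
norm on the positive cone, i.e. the trace. -/
noncomputable def Psi (ϱ : TraceClassSA 𝔥) : ℝ := (trace ϱ.op).re

end TraceClassSA

end TraceClass

/-! ### Semigroups, generators, resolvents -/

section Semigroups

variable {X : Type*} [NormedAddCommGroup X] [NormedSpace ℝ X]

/-- A `C₀`-semigroup of bounded linear operators; only its values at times `t ≥ 0` matter. -/
structure C0Semigroup (X : Type*) [NormedAddCommGroup X] [NormedSpace ℝ X] where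
  toFun : ℝ → X →L[ℝ] X
  map_zero : toFun 0 = ContinuousLinearMap.id ℝ X
  map_add : ∀ s t, 0 ≤ s → 0 ≤ t → toFun (s + t) = (toFun s).comp (toFun t)
  continuous_at_zero : ∀ u, Tendsto (fun t => toFun t u) (𝓝[≥] 0) (𝓝 u)

/-- `v` is the derivative at `0` of the trajectory of `u`. -/
def C0Semigroup.HasDeriv (T : C0Semigroup X) (u v : X) : Prop :=
  Tendsto (fun t : ℝ => t⁻¹ • (T.toFun t u - u)) (𝓝[>] 0) (𝓝 v)

theorem C0Semigroup.HasDeriv.add {T : C0Semigroup X} {u v u' v' : X} (h : T.HasDeriv u v)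
    (h' : T.HasDeriv u' v') : T.HasDeriv (u + u') (v + v') := by
  refine (Tendsto.add h h').congr fun t => ?_
  rw [ContinuousLinearMap.map_add, ← smul_add]
  congr 1
  abel

theorem C0Semigroup.HasDeriv.smul {T : C0Semigroup X} {u v : X} (c : ℝ) (h : T.HasDeriv u v) :
    T.HasDeriv (c • u) (c • v) := by
  refine (Tendsto.const_smul h c).congr fun t => ?_
  rw [ContinuousLinearMap.map_smul, ← smul_sub, smul_comm]

theorem C0Semigroup.HasDeriv.unique {T : C0Semigroup X} {u v v' : X} (h : T.HasDeriv u v)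
    (h' : T.HasDeriv u v') : v = v' :=
  tendsto_nhds_unique h h'

/-- The generator of a `C₀`-semigroup, on the domain where the derivative at `0` exists. -/
noncomputable def C0Semigroup.generator (T : C0Semigroup X) : X →ₗ.[ℝ] X where
  domain :=
    { carrier := {u | ∃ v, T.HasDeriv u v}
      zero_mem' := ⟨0, by simp [C0Semigroup.HasDeriv]⟩
      add_mem' := fun ⟨v, hv⟩ ⟨w, hw⟩ => ⟨v + w, hv.add hw⟩
      smul_mem' := fun c _ ⟨v, hv⟩ => ⟨c • v, hv.smul c⟩ }
  toFun :=
    { toFun := fun u => u.2.choose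
      map_add' := fun u v => (u + v).2.choose_spec.unique (u.2.choose_spec.add v.2.choose_spec)
      map_smul' := fun c u => (c • u).2.choose_spec.unique (u.2.choose_spec.smul c) }

/-- `(c - A)⁻¹ u`, the element `v` of the domain of `A` with `c v - A v = u`. -/
noncomputable def resolvent (A : X →ₗ.[ℝ] X) (c : ℝ) (u : X) : A.domain :=
  Function.invFun (fun v : A.domain => c • (v : X) - A v) u

/-- `A + B` with domain that of `A`. -/
def perturb (A : X →ₗ.[ℝ] X) (B : A.domain →ₗ[ℝ] X) : X →ₗ.[ℝ] X :=
  ⟨A.domain, A.toFun + B⟩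

/-- The operator `B (c - A)⁻¹`. -/
noncomputable def perturbResolvent (A : X →ₗ.[ℝ] X) (B : A.domain →ₗ[ℝ] X) (c : ℝ) (u : X) : X :=
  B (resolvent A c u)

/-- A `C₀`-semigroup that is positive and contracting on the positive cone. -/
def IsSubstochastic [PartialOrder X] (T : C0Semigroup X) : Prop :=
  ∀ t : ℝ, 0 ≤ t → ∀ u : X, 0 ≤ u → 0 ≤ T.toFun t u ∧ ‖T.toFun t u‖ ≤ ‖u‖

/-- `V` is the smallest substochastic `C₀`-semigroup whose generator extends `A + B`. -/
structure IsMinimalSemigroup [PartialOrder X] (A : X →ₗ.[ℝ] X) (B : A.domain →ₗ[ℝ] X)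
    (V : C0Semigroup X) : Prop where
  substochastic : IsSubstochastic V
  extends_perturb : perturb A B ≤ V.generator
  minimal : ∀ S : C0Semigroup X, IsSubstochastic S → perturb A B ≤ S.generator →
    ∀ t : ℝ, 0 ≤ t → ∀ u : X, 0 ≤ u → V.toFun t u ≤ S.toFun t u

/-! ### The functionals of honesty theory -/

/-- `a₀(v) = -⟨Ψ, G v⟩` on the domain of `G`. -/
def aZero (Ψ : X → ℝ) (G : X →ₗ.[ℝ] X) (v : G.domain) : ℝ := -Ψ (G v)

/-- `a(v) = -⟨Ψ, A v + B v⟩` on the domain of `A`. -/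
def aFun (Ψ : X → ℝ) (A : X →ₗ.[ℝ] X) (B : A.domain →ₗ[ℝ] X) (v : A.domain) : ℝ :=
  -Ψ (A v + B v)

/-- The functional on the domain of `G` that takes at `(c - G)⁻¹ u` the value
`∑ₙ a((c - A)⁻¹ [B (c - A)⁻¹]ⁿ u)`. -/
noncomputable def aBar (Ψ : X → ℝ) (A : X →ₗ.[ℝ] X) (B : A.domain →ₗ[ℝ] X) (G : X →ₗ.[ℝ] X)
    (c : ℝ) (v : G.domain) : ℝ :=
  ∑' n : ℕ, aFun Ψ A B (resolvent A c ((perturbResolvent A B c)^[n] (c • (v : X) - G v)))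

/-- The functional `Ξ_c`, that is `⟨Ξ_c, u⟩ = a₀((c - G)⁻¹ u) - ā((c - G)⁻¹ u)`. -/
noncomputable def Xi (Ψ : X → ℝ) (A : X →ₗ.[ℝ] X) (B : A.domain →ₗ[ℝ] X) (G : X →ₗ.[ℝ] X)
    (c : ℝ) (u : X) : ℝ :=
  aZero Ψ G (resolvent G c u) - aBar Ψ A B G c (resolvent G c u)

/-- The set `𝓗` of the positive `u` with `⟨Ξ_c, u⟩ = 0` for every `c > 0`. -/
def honestSet [PartialOrder X] (Ψ : X → ℝ) (A : X →ₗ.[ℝ] X) (B : A.domain →ₗ[ℝ] X)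
    (G : X →ₗ.[ℝ] X) : Set X :=
  {u | 0 ≤ u ∧ ∀ c : ℝ, 0 < c → Xi Ψ A B G c u = 0}

end Semigroups

/-- The positive bounded operator `β` represents the functional `ξ`:
`⟨ξ, ϱ⟩ = Trace (β ϱ)` for all positive trace class operators `ϱ`. -/
def Represents {𝔥 : Type*} [NormedAddCommGroup 𝔥] [InnerProductSpace ℂ 𝔥] [CompleteSpace 𝔥]
    (β : 𝔥 →L[ℂ] 𝔥) (ξ : TraceClassSA 𝔥 → ℝ) : Prop :=
  β.IsPositive ∧ ∀ ϱ : TraceClassSA 𝔥, 0 ≤ ϱ → (ξ ϱ : ℂ) = trace (β ∘L ϱ.op)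

end Honesty

/-!
The theorem combines Kato's perturbation theory with the duality between trace class operators and
bounded operators.

*Resolvents.* Write `A`, `G` for the generators of the given and of the minimal semigroup and
`K = B (c - A)⁻¹`. On positive vectors `⟨Ψ, (A + B) v⟩ ≤ 0` says `‖K u‖ + c ‖(c - A)⁻¹ u‖ ≤ ‖u‖`, so
the series `∑ₙ (c - A)⁻¹ Kⁿ` converges, and since the norm is additive on the cone it inherits the
resolvent identity and the strong limit `c R(c) → 1`. The Hille–Yosida theorem
(`IsContractionResolvent.exists_semigroup`) turns it into the resolvent of a substochastic semigroup
whose generator extends `A + B`. Minimality bounds `(c - G)⁻¹` above by the series, and the partial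
sums are `(c - G)⁻¹ (u - Kᴺ u) ≤ (c - G)⁻¹ u`, so `(c - G)⁻¹` is the series
(`IsKatoPerturbation.res_eq_katoRes`).

*The functionals.* The series defining `Ξ_c` now telescopes to `⟨Ξ_c, u⟩ = lim_N ⟨Ψ, Kᴺ u⟩`, so `Ξ_c`
is linear with `0 ≤ ⟨Ξ_c, u⟩ ≤ ‖u‖` on the cone. For `c < d` one gets
`Ξ_c = Ξ_d ∘ (1 + (d - c) (c - G)⁻¹)` on the cone (`IsKatoPerturbation.Xi_add_eq`). Hence a zero of
`Ξ_c` is one of `Ξ_d`; letting `d ↓ c` shows that the zeros of `Ξ_c` are invariant under `(c - G)⁻¹`,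
and a Neumann series then reaches the parameters below `c`. So the positive zeros of `Ξ_c` do not
depend on `c` (`IsKatoPerturbation.Xi_eq_zero`).

*Representation.* The trace class is complete, because the trace norm is lower semicontinuous.
A positive functional on it is a positive bounded quadratic form on rank one operators, which gives
`β`. The expansion `ϱ = ∑ᵢ |√ϱ eᵢ⟩⟨√ϱ eᵢ|` in the trace norm, together with
`Trace (A* B) = Trace (B A*)` for Hilbert–Schmidt operators, gives
`⟨Ξ, ϱ⟩ = Trace (β ϱ) = ∑ᵢ ⟨√ϱ eᵢ, β √ϱ eᵢ⟩` for every positive `ϱ`. This vanishes exactly when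
`β ϱ = 0`, that is, when the range of `ϱ` lies in the null space of `β`
(`Represents.eq_zero_iff`). For rank one `ϱ` this identifies the null space of `β` with zeros of `Ξ`,
whence its independence of the parameter. For differences of elements of `𝓗` the Jordan
decomposition is used, whose parts have their ranges in that of `ϱ` (`mul_posPart_eq_zero`).
-/

namespace Honesty

/-! ### Contraction semigroups and their resolvents -/

section ContractionSemigroups

open MeasureTheory Set

variable {X : Type*} [NormedAddCommGroup X] [NormedSpace ℝ X]

/-- A `C₀`-semigroup of contractions. -/
def C0Semigroup.IsContraction (T : C0Semigroup X) : Prop :=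
  ∀ t : ℝ, 0 ≤ t → ∀ u : X, ‖T.toFun t u‖ ≤ ‖u‖

namespace C0Semigroup

variable {T : C0Semigroup X}

theorem hasDeriv_generator (v : T.generator.domain) : T.HasDeriv (v : X) (T.generator v) :=
  v.2.choose_spec

theorem HasDeriv.mem_domain {u v : X} (h : T.HasDeriv u v) : u ∈ T.generator.domain :=
  ⟨v, h⟩

theorem HasDeriv.generator_eq {u v : X} (h : T.HasDeriv u v) :
    T.generator ⟨u, h.mem_domain⟩ = v :=
  (hasDeriv_generator _).unique h

/-- Dissipativity of the generator of a contraction semigroup. -/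
theorem IsContraction.norm_le (hT : T.IsContraction) {u v : X} (h : T.HasDeriv u v) {c : ℝ}
    (hc : 0 < c) : c * ‖u‖ ≤ ‖c • u - v‖ := by
  have h1 : Tendsto (fun t : ℝ => ‖c • u - t⁻¹ • (T.toFun t u - u)‖) (𝓝[>] 0)
      (𝓝 ‖c • u - v‖) := (tendsto_const_nhds.sub h).norm
  refine ge_of_tendsto h1 ?_
  filter_upwards [self_mem_nhdsWithin] with t ht
  have ht : 0 < t := ht
  have e : c • u - t⁻¹ • (T.toFun t u - u) = (c + t⁻¹) • u - t⁻¹ • T.toFun t u := by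
    module
  have h2 : ‖(c + t⁻¹) • u‖ = (c + t⁻¹) * ‖u‖ := by
    rw [norm_smul, Real.norm_of_nonneg (by positivity)]
  have h3 : ‖t⁻¹ • T.toFun t u‖ ≤ t⁻¹ * ‖u‖ := by
    rw [norm_smul, Real.norm_of_nonneg (by positivity)]
    exact mul_le_mul_of_nonneg_left (hT t ht.le u) (by positivity)
  have h4 := norm_sub_norm_le ((c + t⁻¹) • u) (t⁻¹ • T.toFun t u)
  rw [e]
  linarith [add_mul c t⁻¹ ‖u‖]

theorem IsContraction.norm_sub_le (hT : T.IsContraction) (u : X) {s t : ℝ} (hs : 0 ≤ s)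
    (ht : 0 ≤ t) : ‖T.toFun t u - T.toFun s u‖ ≤ ‖T.toFun |t - s| u - u‖ := by
  wlog h : s ≤ t generalizing s t
  · rw [norm_sub_rev, abs_sub_comm]
    exact this ht hs (le_of_not_ge h)
  · have e : T.toFun t u = T.toFun s (T.toFun (t - s) u) := by
      conv_lhs => rw [← add_sub_cancel s t, T.map_add s (t - s) hs (sub_nonneg.2 h)]
      rfl
    rw [e, abs_of_nonneg (sub_nonneg.2 h), ← map_sub]
    exact hT s hs _

theorem IsContraction.continuousOn (hT : T.IsContraction) (u : X) :
    ContinuousOn (fun t => T.toFun t u) (Ici 0) := by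
  intro s hs
  rw [ContinuousWithinAt, tendsto_iff_norm_sub_tendsto_zero]
  have h1 : Tendsto (fun t : ℝ => |t - s|) (𝓝[Ici 0] s) (𝓝[≥] 0) := by
    refine tendsto_nhdsWithin_iff.2 ⟨?_, Eventually.of_forall fun t => Set.mem_Ici.2 (abs_nonneg _)⟩
    have : Tendsto (fun t : ℝ => |t - s|) (𝓝 s) (𝓝 |s - s|) :=
      (continuous_abs.comp (continuous_id.sub continuous_const)).tendsto s
    rw [sub_self, abs_zero] at this
    exact this.mono_left nhdsWithin_le_nhds
  have h2 : Tendsto (fun t : ℝ => ‖T.toFun |t - s| u - u‖) (𝓝[Ici 0] s) (𝓝 0) := by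
    have := (tendsto_iff_norm_sub_tendsto_zero.1 (T.continuous_at_zero u)).comp h1
    exact this
  refine tendsto_of_tendsto_of_tendsto_of_le_of_le' tendsto_const_nhds h2
    (Eventually.of_forall fun t => norm_nonneg _) ?_
  filter_upwards [self_mem_nhdsWithin] with t ht
  exact hT.norm_sub_le u hs ht

theorem IsContraction.integrableOn (hT : T.IsContraction) (u : X) {c : ℝ} (hc : 0 < c) :
    IntegrableOn (fun t => Real.exp (-c * t) • T.toFun t u) (Ioi 0) := by
  have h0 : IntegrableOn (fun t => Real.exp (-c * t) * ‖u‖) (Ioi 0) :=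
    (integrableOn_exp_mul_Ioi (neg_lt_zero.2 hc) 0).mul_const _
  refine Integrable.mono' h0 ?_ ?_
  · refine ContinuousOn.aestronglyMeasurable ?_ measurableSet_Ioi
    exact ContinuousOn.smul (by fun_prop) ((hT.continuousOn u).mono Ioi_subset_Ici_self)
  · filter_upwards [ae_restrict_mem measurableSet_Ioi] with t ht
    rw [norm_smul, Real.norm_of_nonneg (Real.exp_pos _).le]
    exact mul_le_mul_of_nonneg_left (hT t (le_of_lt ht) u) (Real.exp_pos _).le

/-- The Laplace transform `∫₀^∞ e^{-ct} T(t) u dt`. -/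
noncomputable def laplace (T : C0Semigroup X) (c : ℝ) (u : X) : X :=
  ∫ t in Ioi (0 : ℝ), Real.exp (-c * t) • T.toFun t u

theorem IsContraction.norm_laplace_le (hT : T.IsContraction) (u : X) {c : ℝ} (hc : 0 < c) :
    ‖T.laplace c u‖ ≤ c⁻¹ * ‖u‖ := by
  have h0 : IntegrableOn (fun t => Real.exp (-c * t) * ‖u‖) (Ioi 0) :=
    (integrableOn_exp_mul_Ioi (neg_lt_zero.2 hc) 0).mul_const _
  refine (norm_integral_le_of_norm_le h0 ?_).trans_eq ?_
  · filter_upwards [ae_restrict_mem measurableSet_Ioi] with t ht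
    rw [norm_smul, Real.norm_of_nonneg (Real.exp_pos _).le]
    exact mul_le_mul_of_nonneg_left (hT t (le_of_lt ht) u) (Real.exp_pos _).le
  · rw [integral_mul_const, integral_exp_mul_Ioi (neg_lt_zero.2 hc) 0]
    simp

variable [CompleteSpace X]

theorem IsContraction.map_laplace (hT : T.IsContraction) (u : X) {c : ℝ} (hc : 0 < c) {h : ℝ}
    (hh : 0 ≤ h) : T.toFun h (T.laplace c u) =
      Real.exp (c * h) • (T.laplace c u - ∫ t in (0 : ℝ)..h, Real.exp (-c * t) • T.toFun t u) := by
  have hi := hT.integrableOn u hc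
  have e1 : ∫ t in Ioi h, Real.exp (-c * t) • T.toFun t u
      = T.laplace c u - ∫ t in (0 : ℝ)..h, Real.exp (-c * t) • T.toFun t u := by
    rw [eq_sub_iff_add_eq, add_comm]
    exact intervalIntegral.integral_interval_add_Ioi hi (hi.mono_set (Ioi_subset_Ioi hh))
  rw [← e1, laplace, ← ContinuousLinearMap.integral_comp_comm _ hi, ← integral_smul]
  have e2 := (measurePreserving_add_right (volume : Measure ℝ) h).setIntegral_preimage_emb
    (measurableEmbedding_addRight h)
    (fun t => Real.exp (c * h) • Real.exp (-c * t) • T.toFun t u) (Ioi h)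
  rw [preimage_add_const_Ioi, sub_self] at e2
  rw [← e2]
  refine setIntegral_congr_fun measurableSet_Ioi fun t ht => ?_
  have ht : 0 ≤ t := le_of_lt ht
  change T.toFun h (Real.exp (-c * t) • T.toFun t u) = _
  rw [map_smul, smul_smul, ← Real.exp_add, add_comm t h, T.map_add h t hh ht]
  congr 2
  ring

theorem IsContraction.hasDeriv_laplace (hT : T.IsContraction) (u : X) {c : ℝ} (hc : 0 < c) :
    T.HasDeriv (T.laplace c u) (c • T.laplace c u - u) := by
  have hcont : ContinuousOn (fun t => Real.exp (-c * t) • T.toFun t u) (Ici 0) :=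
    ContinuousOn.smul (by fun_prop) (hT.continuousOn u)
  have hF : HasDerivWithinAt (fun h => ∫ t in (0 : ℝ)..h, Real.exp (-c * t) • T.toFun t u)
      (Real.exp (-c * 0) • T.toFun 0 u) (Ici 0) 0 := by
    refine intervalIntegral.integral_hasDerivWithinAt_right (t := Ioi 0) (by simp) ?_ ?_
    · exact ⟨Ioi 0, self_mem_nhdsWithin,
        (hcont.mono Ioi_subset_Ici_self).aestronglyMeasurable measurableSet_Ioi⟩
    · exact (hcont 0 self_mem_Ici).mono Ioi_subset_Ici_self
  have hE : HasDerivWithinAt (fun h : ℝ => Real.exp (c * h)) (Real.exp (c * 0) * (c * 1))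
      (Ici 0) 0 := (((hasDerivAt_id (0 : ℝ)).const_mul c).exp).hasDerivWithinAt
  have hφ := hE.smul (hF.const_sub (T.laplace c u))
  have hφ' := (hasDerivWithinAt_iff_tendsto_slope' (by simp)).1 (hφ.mono Ioi_subset_Ici_self)
  simp only [mul_zero, Real.exp_zero, one_smul, T.map_zero, ContinuousLinearMap.id_apply,
    intervalIntegral.integral_same, sub_zero, mul_one, one_mul] at hφ'
  have e : -u + c • T.laplace c u = c • T.laplace c u - u := by abel
  rw [HasDeriv, ← e]
  refine hφ'.congr' ?_
  filter_upwards [self_mem_nhdsWithin] with h hh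
  rw [hT.map_laplace u hc (le_of_lt hh), slope_def_module]
  simp

theorem IsContraction.laplace_eq (hT : T.IsContraction) {u v : X} (h : T.HasDeriv u v) {c : ℝ}
    (hc : 0 < c) : T.laplace c (c • u - v) = u := by
  have h1 := hT.hasDeriv_laplace (c • u - v) hc
  have h2 := hT.norm_le (h1.add (h.smul (-1))) hc
  set w := T.laplace c (c • u - v)
  have e : c • (w + (-1 : ℝ) • u) - (c • w - (c • u - v) + (-1 : ℝ) • v) = 0 := by module
  rw [e, norm_zero] at h2
  have h3 : ‖w + (-1 : ℝ) • u‖ ≤ 0 := nonpos_of_mul_nonpos_right h2 hc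
  have h4 := norm_le_zero_iff.1 h3
  rwa [neg_one_smul, ← sub_eq_add_neg, sub_eq_zero] at h4

/-- The resolvent `(c - A)⁻¹` of the generator of a contraction semigroup, as a bounded
operator (for `c > 0`; it is `0` if the semigroup is not contractive or `c ≤ 0`). -/
noncomputable def res (T : C0Semigroup X) (c : ℝ) : X →L[ℝ] X :=
  open scoped Classical in
  if h : T.IsContraction ∧ 0 < c then
    LinearMap.mkContinuous
      { toFun := T.laplace c
        map_add' := fun u v => by
          rw [laplace, laplace, laplace,
            ← integral_add (h.1.integrableOn u h.2) (h.1.integrableOn v h.2)]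
          simp
        map_smul' := fun a u => by
          rw [laplace, laplace, ← integral_smul]
          simp only [map_smul, RingHom.id_apply]
          exact integral_congr_ae (Eventually.of_forall fun t => smul_comm _ _ _) }
      c⁻¹ fun u => h.1.norm_laplace_le u h.2
  else 0

theorem IsContraction.res_apply (hT : T.IsContraction) {c : ℝ} (hc : 0 < c) (u : X) :
    T.res c u = T.laplace c u := by
  rw [res, dif_pos ⟨hT, hc⟩]
  rfl

theorem IsContraction.hasDeriv_res (hT : T.IsContraction) {c : ℝ} (hc : 0 < c) (u : X) :
    T.HasDeriv (T.res c u) (c • T.res c u - u) := by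
  rw [hT.res_apply hc]
  exact hT.hasDeriv_laplace u hc

theorem IsContraction.res_eq (hT : T.IsContraction) {c : ℝ} (hc : 0 < c) {u v : X}
    (h : T.HasDeriv u v) : T.res c (c • u - v) = u := by
  rw [hT.res_apply hc]
  exact hT.laplace_eq h hc

theorem IsContraction.norm_res_le (hT : T.IsContraction) {c : ℝ} (hc : 0 < c) (u : X) :
    ‖T.res c u‖ ≤ c⁻¹ * ‖u‖ := by
  rw [hT.res_apply hc]
  exact hT.norm_laplace_le u hc

theorem IsContraction.res_sub_res (hT : T.IsContraction) {c d : ℝ} (hc : 0 < c) (hd : 0 < d)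
    (u : X) : T.res c u - T.res d u = (d - c) • T.res c (T.res d u) := by
  have h := hT.res_eq hc (hT.hasDeriv_res hd u)
  have e : c • T.res d u - (d • T.res d u - u) = u - (d - c) • T.res d u := by module
  rw [e, map_sub, map_smul] at h
  rw [sub_eq_iff_eq_add'] at h
  rw [h]
  abel

theorem IsContraction.resolvent_eq (hT : T.IsContraction) {c : ℝ} (hc : 0 < c) (u : X) :
    resolvent T.generator c u = ⟨T.res c u, (hT.hasDeriv_res hc u).mem_domain⟩ := by
  have hu : ∃ v : T.generator.domain, c • (v : X) - T.generator v = u := by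
    refine ⟨⟨T.res c u, (hT.hasDeriv_res hc u).mem_domain⟩, ?_⟩
    rw [(hT.hasDeriv_res hc u).generator_eq]
    abel
  have h := Function.invFun_eq hu
  change c • (resolvent T.generator c u : X) - T.generator (resolvent T.generator c u) = u at h
  refine Subtype.ext ?_
  have h2 := hT.res_eq hc (hasDeriv_generator (resolvent T.generator c u))
  rw [h] at h2
  exact h2.symm

/-- Strong convergence `c (c - A)⁻¹ → 1` as `c → ∞`: after rescaling, dominated convergence. -/
theorem IsContraction.tendsto_smul_res (hT : T.IsContraction) (u : X) :
    Tendsto (fun c : ℝ => c • T.res c u) atTop (𝓝 u) := by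
  have h1 : Tendsto (fun c : ℝ => ∫ s in Ioi (0 : ℝ), Real.exp (-1 * s) • T.toFun (c⁻¹ * s) u)
      atTop (𝓝 (∫ s in Ioi (0 : ℝ), Real.exp (-1 * s) • u)) := by
    refine tendsto_integral_filter_of_dominated_convergence (fun s => Real.exp (-1 * s) * ‖u‖)
      ?_ ?_ ?_ ?_
    · filter_upwards [eventually_gt_atTop 0] with c hc
      refine ContinuousOn.aestronglyMeasurable ?_ measurableSet_Ioi
      refine ContinuousOn.smul (by fun_prop) ?_
      refine (hT.continuousOn u).comp (by fun_prop) fun s hs => ?_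
      exact mul_nonneg (inv_nonneg.2 hc.le) (le_of_lt hs)
    · filter_upwards [eventually_gt_atTop 0] with c hc
      filter_upwards [ae_restrict_mem measurableSet_Ioi] with s hs
      rw [norm_smul, Real.norm_of_nonneg (Real.exp_pos _).le]
      exact mul_le_mul_of_nonneg_left
        (hT _ (mul_nonneg (inv_nonneg.2 hc.le) (le_of_lt hs)) u) (Real.exp_pos _).le
    · exact (integrableOn_exp_mul_Ioi (by norm_num) 0).mul_const _
    · filter_upwards [ae_restrict_mem measurableSet_Ioi] with s hs
      refine Tendsto.const_smul ?_ _
      have h2 : Tendsto (fun c : ℝ => c⁻¹ * s) atTop (𝓝[≥] 0) := by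
        refine tendsto_nhdsWithin_iff.2 ⟨?_, ?_⟩
        · simpa using tendsto_inv_atTop_zero.mul_const s
        · filter_upwards [eventually_gt_atTop 0] with c hc
          exact mul_nonneg (inv_nonneg.2 hc.le) (le_of_lt hs)
      exact (T.continuous_at_zero u).comp h2
  have h2 : ∫ s in Ioi (0 : ℝ), Real.exp (-1 * s) • u = u := by
    rw [integral_smul_const, integral_exp_mul_Ioi (by norm_num) 0]
    simp
  rw [h2] at h1
  refine h1.congr' ?_
  filter_upwards [eventually_gt_atTop 0] with c hc
  rw [hT.res_apply hc, laplace]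
  have h3 := integral_comp_mul_left_Ioi
    (fun s => Real.exp (-1 * s) • T.toFun (c⁻¹ * s) u) 0 hc
  rw [mul_zero] at h3
  rw [← inv_smul_eq_iff₀ hc.ne', ← h3]
  refine setIntegral_congr_fun measurableSet_Ioi fun t _ => ?_
  rw [inv_mul_cancel_left₀ hc.ne', neg_one_mul, neg_mul]

variable [PartialOrder X] [IsOrderedAddMonoid X] [IsOrderedModule ℝ X] [OrderClosedTopology X]

theorem IsContraction.res_mono {S : C0Semigroup X} (hT : T.IsContraction) (hS : S.IsContraction)
    {c : ℝ} (hc : 0 < c) {u : X} (h : ∀ t, 0 ≤ t → T.toFun t u ≤ S.toFun t u) :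
    T.res c u ≤ S.res c u := by
  rw [hT.res_apply hc, hS.res_apply hc]
  refine integral_mono_ae (hT.integrableOn u hc) (hS.integrableOn u hc) ?_
  filter_upwards [ae_restrict_mem measurableSet_Ioi] with t ht
  exact smul_le_smul_of_nonneg_left (h t (le_of_lt ht)) (Real.exp_pos _).le

theorem IsContraction.res_nonneg (hT : T.IsContraction) {c : ℝ} (hc : 0 < c) {u : X}
    (h : ∀ t, 0 ≤ t → 0 ≤ T.toFun t u) : 0 ≤ T.res c u := by
  rw [hT.res_apply hc]
  refine integral_nonneg_of_ae ?_
  filter_upwards [ae_restrict_mem measurableSet_Ioi] with t ht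
  exact smul_nonneg (Real.exp_pos _).le (h t (le_of_lt ht))

end C0Semigroup

end ContractionSemigroups

/-! ### Generation of semigroups by pseudo-resolvents -/

section HilleYosida

open Set

variable {X : Type*} [NormedAddCommGroup X] [NormedSpace ℝ X] [CompleteSpace X]

theorem hasSum_exp_apply (A : X →L[ℝ] X) (u : X) :
    HasSum (fun n : ℕ => (n.factorial : ℝ)⁻¹ • (A ^ n) u) (NormedSpace.exp A u) :=
  (NormedSpace.exp_series_hasSum_exp' (𝕂 := ℝ) A).mapL (ContinuousLinearMap.apply ℝ X u)

theorem norm_exp_apply_le (A : X →L[ℝ] X) {a : ℝ} (hA : ∀ u, ‖A u‖ ≤ a * ‖u‖) (ha : 0 ≤ a)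
    (u : X) : ‖NormedSpace.exp A u‖ ≤ Real.exp a * ‖u‖ := by
  have hpow : ∀ n : ℕ, ‖(A ^ n) u‖ ≤ a ^ n * ‖u‖ := by
    intro n
    induction n with
    | zero => simp
    | succ n ih =>
      rw [pow_succ', mul_apply_eq_comp]
      calc ‖A ((A ^ n) u)‖ ≤ a * ‖(A ^ n) u‖ := hA _
        _ ≤ a * (a ^ n * ‖u‖) := mul_le_mul_of_nonneg_left ih ha
        _ = a ^ (n + 1) * ‖u‖ := by ring
  have hs : HasSum (fun n : ℕ => (n.factorial : ℝ)⁻¹ • a ^ n * ‖u‖) (Real.exp a * ‖u‖) := by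
    rw [Real.exp_eq_exp_ℝ]
    exact (NormedSpace.exp_series_hasSum_exp' (𝕂 := ℝ) a).mul_right _
  rw [← (hasSum_exp_apply A u).tsum_eq]
  refine tsum_of_norm_bounded hs fun n => ?_
  rw [norm_smul, Real.norm_of_nonneg (by positivity), smul_eq_mul, mul_assoc]
  exact mul_le_mul_of_nonneg_left (hpow n) (by positivity)

theorem exp_add_smul_one (A : X →L[ℝ] X) (a : ℝ) :
    NormedSpace.exp (A + a • (1 : X →L[ℝ] X)) = Real.exp a • NormedSpace.exp A := by
  let _ : NormedAlgebra ℚ (X →L[ℝ] X) := NormedAlgebra.restrictScalars ℚ ℝ _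
  have h1 : Commute A (a • (1 : X →L[ℝ] X)) := (Commute.one_right A).smul_right a
  have h2 : NormedSpace.exp (a • (1 : X →L[ℝ] X)) = Real.exp a • (1 : X →L[ℝ] X) := by
    have := NormedSpace.algebraMap_exp_comm (𝔸 := X →L[ℝ] X) a
    rw [Algebra.algebraMap_eq_smul_one, Algebra.algebraMap_eq_smul_one] at this
    rw [← this, Real.exp_eq_exp_ℝ]
  rw [NormedSpace.exp_add_of_commute h1, h2, mul_smul_one]

theorem exp_smul_add (A : X →L[ℝ] X) (s t : ℝ) :
    NormedSpace.exp ((s + t) • A) = NormedSpace.exp (s • A) * NormedSpace.exp (t • A) := by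
  let _ : NormedAlgebra ℚ (X →L[ℝ] X) := NormedAlgebra.restrictScalars ℚ ℝ _
  rw [add_smul]
  exact NormedSpace.exp_add_of_commute (((Commute.refl A).smul_left s).smul_right t)

theorem hasDerivAt_exp_smul_apply (A : X →L[ℝ] X) (u : X) (t : ℝ) :
    HasDerivAt (fun s : ℝ => NormedSpace.exp (s • A) u) (NormedSpace.exp (t • A) (A u)) t :=
  ((ContinuousLinearMap.apply ℝ X u).hasFDerivAt.comp_hasDerivAt t
    (hasDerivAt_exp_smul_const A t))

/-- Commuting bounded generators of contraction semigroups: differentiate `e^{sA} e^{(t-s)B} u` in `s`. -/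
theorem norm_exp_sub_exp_le {A B : X →L[ℝ] X} (hAB : Commute A B)
    (hA : ∀ s : ℝ, 0 ≤ s → ∀ u, ‖NormedSpace.exp (s • A) u‖ ≤ ‖u‖)
    (hB : ∀ s : ℝ, 0 ≤ s → ∀ u, ‖NormedSpace.exp (s • B) u‖ ≤ ‖u‖) {t : ℝ} (ht : 0 ≤ t) (u : X) :
    ‖NormedSpace.exp (t • A) u - NormedSpace.exp (t • B) u‖ ≤ ‖A u - B u‖ * t := by
  have hd : ∀ s : ℝ, HasDerivAt
      (fun s : ℝ => NormedSpace.exp (s • A) (NormedSpace.exp ((t - s) • B) u))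
      (NormedSpace.exp (s • A) (NormedSpace.exp ((t - s) • B) (A u - B u))) s := by
    intro s
    have h1 := hasDerivAt_exp_smul_const A s
    have h2 := (hasDerivAt_exp_smul_apply B u (t - s)).scomp s ((hasDerivAt_id s).const_sub t)
    have h3 := h1.clm_apply h2
    have hc : Commute A (NormedSpace.exp ((t - s) • B)) := (hAB.smul_right (t - s)).exp_right
    have hc' : A (NormedSpace.exp ((t - s) • B) u) = NormedSpace.exp ((t - s) • B) (A u) :=
      congrArg (fun F : X →L[ℝ] X => F u) hc.eq
    have e : NormedSpace.exp (s • A) (NormedSpace.exp ((t - s) • B) (A u - B u))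
        = (NormedSpace.exp (s • A) * A) (NormedSpace.exp ((t - s) • B) u)
          + NormedSpace.exp (s • A) ((-1 : ℝ) • NormedSpace.exp ((t - s) • B) (B u)) := by
      rw [mul_apply_eq_comp, hc', map_sub, map_sub, neg_one_smul, map_neg, sub_eq_add_neg]
    rw [e]
    exact h3
  have h := norm_image_sub_le_of_norm_deriv_le_segment' (a := 0) (b := t)
    (fun s _ => (hd s).hasDerivWithinAt) (C := ‖A u - B u‖)
    (fun s hs => (hA s hs.1 _).trans (hB (t - s) (sub_nonneg.2 hs.2.le) _)) t ⟨ht, le_rfl⟩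
  simpa using h

theorem norm_exp_sub_le {A : X →L[ℝ] X}
    (hA : ∀ s : ℝ, 0 ≤ s → ∀ u, ‖NormedSpace.exp (s • A) u‖ ≤ ‖u‖) {t : ℝ} (ht : 0 ≤ t) (u : X) :
    ‖NormedSpace.exp (t • A) u - u‖ ≤ ‖A u‖ * t := by
  have h := norm_exp_sub_exp_le (Commute.zero_right A) hA (fun s _ u => by simp) ht u
  simpa using h

theorem norm_exp_sub_sub_le {A : X →L[ℝ] X} {t : ℝ} (ht : 0 ≤ t) (u : X) {C : ℝ}
    (hC : ∀ s ∈ Icc 0 t, ‖NormedSpace.exp (s • A) (A u) - A u‖ ≤ C) :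
    ‖NormedSpace.exp (t • A) u - u - t • A u‖ ≤ C * t := by
  have hd : ∀ s : ℝ, HasDerivAt (fun s : ℝ => NormedSpace.exp (s • A) u - s • A u)
      (NormedSpace.exp (s • A) (A u) - A u) s := by
    intro s
    have := (hasDerivAt_exp_smul_apply A u s).sub ((hasDerivAt_id s).smul_const (A u))
    rwa [one_smul] at this
  have h := norm_image_sub_le_of_norm_deriv_le_segment' (a := 0) (b := t)
    (fun s _ => (hd s).hasDerivWithinAt) (C := C) (fun s hs => hC s ⟨hs.1, hs.2.le⟩) t ⟨ht, le_rfl⟩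
  have e : NormedSpace.exp (t • A) u - u - t • A u = NormedSpace.exp (t • A) u - t • A u - u := by
    abel
  rw [e]
  simpa using h

/-- A pseudo-resolvent `R` on `(0, ∞)` with `‖c R(c)‖ ≤ 1` and `c R(c) → 1` strongly as
`c → ∞`, that is, the resolvent family of the generator of a contraction semigroup. -/
structure IsContractionResolvent (R : ℝ → X →L[ℝ] X) : Prop where
  norm_le : ∀ c, 0 < c → ∀ u, ‖R c u‖ ≤ c⁻¹ * ‖u‖
  sub_eq : ∀ c d, 0 < c → 0 < d → ∀ u, R c u - R d u = (d - c) • R c (R d u)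
  tendsto : ∀ u, Tendsto (fun c => c • R c u) atTop (𝓝 u)

/-- The Yosida approximation `c (c R(c) - 1)` of the generator. -/
noncomputable def yosida (R : ℝ → X →L[ℝ] X) (c : ℝ) : X →L[ℝ] X :=
  (c * c) • R c + (-c) • (1 : X →L[ℝ] X)

theorem exp_yosida (R : ℝ → X →L[ℝ] X) (c t : ℝ) : NormedSpace.exp (t • yosida R c)
    = Real.exp (-(t * c)) • NormedSpace.exp ((t * (c * c)) • R c) := by
  rw [← exp_add_smul_one, yosida, smul_add, smul_smul, smul_smul, mul_neg]

theorem exp_yosida_nonneg [PartialOrder X] [IsOrderedAddMonoid X] [IsOrderedModule ℝ X]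
    [OrderClosedTopology X] {R : ℝ → X →L[ℝ] X} {c : ℝ} (hpos : ∀ u, 0 ≤ u → 0 ≤ R c u) {t : ℝ}
    (ht : 0 ≤ t) {u : X} (hu : 0 ≤ u) : 0 ≤ NormedSpace.exp (t • yosida R c) u := by
  rw [exp_yosida, smul_apply]
  refine smul_nonneg (Real.exp_pos _).le ((hasSum_exp_apply _ u).nonneg fun n => ?_)
  refine smul_nonneg (by positivity) ?_
  induction n with
  | zero => simpa using hu
  | succ n ih =>
    rw [pow_succ', mul_apply_eq_comp, smul_apply]
    exact smul_nonneg (mul_nonneg ht (mul_self_nonneg c)) (hpos _ ih)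

namespace IsContractionResolvent

variable {R : ℝ → X →L[ℝ] X} (hR : IsContractionResolvent R)
include hR

theorem commute {c d : ℝ} (hc : 0 < c) (hd : 0 < d) : Commute (R c) (R d) := by
  by_cases h : c = d
  · rw [h]
  · ext u
    have h1 := hR.sub_eq c d hc hd u
    have h2 := hR.sub_eq d c hd hc u
    have h3 : (d - c) • R c (R d u) = (d - c) • R d (R c u) := by
      rw [← h1, ← neg_sub (R d u), h2, ← neg_smul, neg_sub]
    exact smul_right_injective X (sub_ne_zero.2 (Ne.symm h)) h3

theorem yosida_commute {c d : ℝ} (hc : 0 < c) (hd : 0 < d) :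
    Commute (yosida R c) (yosida R d) := by
  unfold yosida
  refine Commute.add_left (Commute.add_right ?_ ?_) (Commute.add_right ?_ ?_)
  · exact ((hR.commute hc hd).smul_left _).smul_right _
  · exact (Commute.one_right _).smul_right _
  · exact (Commute.one_left _).smul_left _
  · exact (Commute.one_right _).smul_right _

theorem yosida_apply_res {c d : ℝ} (hc : 0 < c) (hd : 0 < d) (u : X) :
    yosida R c (R d u) = c • R c (d • R d u - u) := by
  have h := hR.sub_eq c d hc hd u
  have e : yosida R c (R d u) = c • ((d • R c (R d u) - (d - c) • R c (R d u)) - R d u) := by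
    simp only [yosida, add_apply, smul_apply,
      one_apply_eq_self]
    module
  rw [e, ← h, map_sub, map_smul]
  congr 1
  abel

theorem norm_exp_yosida_le {c : ℝ} (hc : 0 < c) {t : ℝ} (ht : 0 ≤ t) (u : X) :
    ‖NormedSpace.exp (t • yosida R c) u‖ ≤ ‖u‖ := by
  rw [exp_yosida, smul_apply, norm_smul,
    Real.norm_of_nonneg (Real.exp_pos _).le]
  have h1 : ∀ u, ‖((t * (c * c)) • R c) u‖ ≤ (t * c) * ‖u‖ := by
    intro u
    rw [smul_apply, norm_smul, Real.norm_of_nonneg (by positivity)]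
    calc t * (c * c) * ‖R c u‖ ≤ t * (c * c) * (c⁻¹ * ‖u‖) :=
          mul_le_mul_of_nonneg_left (hR.norm_le c hc u) (by positivity)
      _ = t * c * ‖u‖ := by field_simp
  have h2 := norm_exp_apply_le _ h1 (by positivity) u
  calc Real.exp (-(t * c)) * ‖NormedSpace.exp ((t * (c * c)) • R c) u‖
      ≤ Real.exp (-(t * c)) * (Real.exp (t * c) * ‖u‖) :=
        mul_le_mul_of_nonneg_left h2 (Real.exp_pos _).le
    _ = ‖u‖ := by rw [← mul_assoc, ← Real.exp_add, neg_add_cancel, Real.exp_zero, one_mul]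

theorem tendsto_yosida_res {d : ℝ} (hd : 0 < d) (u : X) :
    Tendsto (fun c => yosida R c (R d u)) atTop (𝓝 (d • R d u - u)) := by
  refine (hR.tendsto (d • R d u - u)).congr' ?_
  filter_upwards [eventually_gt_atTop 0] with c hc
  exact (hR.yosida_apply_res hc hd u).symm

/-- Vectors on which the Yosida approximations converge are dense. -/
theorem exists_near (u : X) {ε : ℝ} (hε : 0 < ε) :
    ∃ v w, ‖u - v‖ < ε ∧ Tendsto (fun c => yosida R c v) atTop (𝓝 w) := by
  obtain ⟨d, hd, hd0⟩ := (((tendsto_iff_norm_sub_tendsto_zero.1 (hR.tendsto u)).eventually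
    (gt_mem_nhds hε)).and (eventually_gt_atTop 0)).exists
  refine ⟨d • R d u, d • (d • R d u - u), by rwa [norm_sub_rev], ?_⟩
  simp_rw [map_smul]
  exact (hR.tendsto_yosida_res hd0 u).const_smul d

theorem exists_tendsto_exp {t : ℝ} (ht : 0 ≤ t) (u : X) :
    ∃ v, Tendsto (fun c => NormedSpace.exp (t • yosida R c) u) atTop (𝓝 v) := by
  refine cauchy_map_iff_exists_tendsto.1 (Metric.cauchy_iff.2 ⟨map_neBot, fun ε hε => ?_⟩)
  obtain ⟨v, w, hv, hw⟩ := hR.exists_near u (ε := ε / 4) (by positivity)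
  obtain ⟨s, hs, hs2⟩ := (Metric.cauchy_iff.1 hw.cauchy_map).2 (ε / (4 * (t + 1))) (by positivity)
  have hs : {c | yosida R c v ∈ s} ∈ (atTop : Filter ℝ) := hs
  refine ⟨(fun c => NormedSpace.exp (t • yosida R c) u) '' ({c | yosida R c v ∈ s} ∩ Ioi 0),
    image_mem_map (inter_mem hs (Ioi_mem_atTop 0)), ?_⟩
  rintro _ ⟨c, ⟨hc, hc0⟩, rfl⟩ _ ⟨d, ⟨hd, hd0⟩, rfl⟩
  have h1 := hs2 _ hc _ hd
  rw [dist_eq_norm] at h1 ⊢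
  have hc0 : 0 < c := hc0
  have hd0 : 0 < d := hd0
  have h2 := norm_exp_sub_exp_le (hR.yosida_commute hc0 hd0)
    (fun s hs => hR.norm_exp_yosida_le hc0 hs) (fun s hs => hR.norm_exp_yosida_le hd0 hs) ht v
  have h3 := hR.norm_exp_yosida_le hc0 ht (u - v)
  have h4 := hR.norm_exp_yosida_le hd0 ht (u - v)
  have h5 : ‖yosida R c v - yosida R d v‖ * t ≤ ε / 4 := by
    calc _ ≤ ε / (4 * (t + 1)) * (t + 1) := by
          refine mul_le_mul h1.le (by linarith) ht (by positivity)
      _ = ε / 4 := by field_simp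
  change ‖NormedSpace.exp (t • yosida R c) u - NormedSpace.exp (t • yosida R d) u‖ < ε
  have e : NormedSpace.exp (t • yosida R c) u - NormedSpace.exp (t • yosida R d) u
      = NormedSpace.exp (t • yosida R c) (u - v) - NormedSpace.exp (t • yosida R d) (u - v)
      + (NormedSpace.exp (t • yosida R c) v - NormedSpace.exp (t • yosida R d) v) := by
    rw [map_sub, map_sub]
    abel
  rw [e]
  have h6 := norm_add_le (NormedSpace.exp (t • yosida R c) (u - v)
    - NormedSpace.exp (t • yosida R d) (u - v))
    (NormedSpace.exp (t • yosida R c) v - NormedSpace.exp (t • yosida R d) v)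
  have h7 := norm_sub_le (NormedSpace.exp (t • yosida R c) (u - v))
    (NormedSpace.exp (t • yosida R d) (u - v))
  linarith

/-- The orbits of `u` under the Yosida exponentials are continuous at `0`, uniformly for large
parameters `c`. -/
theorem eventually_norm_exp_sub_le (u : X) {ε : ℝ} (hε : 0 < ε) :
    ∃ δ : ℝ, 0 < δ ∧ ∀ᶠ c in atTop, ∀ t : ℝ, 0 ≤ t → t ≤ δ →
      ‖NormedSpace.exp (t • yosida R c) u - u‖ ≤ ε := by
  obtain ⟨v, w, hv, hw⟩ := hR.exists_near u (ε := ε / 4) (by positivity)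
  refine ⟨ε / (4 * (‖w‖ + 1)), by positivity, ?_⟩
  filter_upwards [hw.norm.eventually (gt_mem_nhds (lt_add_one ‖w‖)), eventually_gt_atTop 0]
    with c hc hc0 t ht htd
  have h1 := norm_exp_sub_le (fun s hs => hR.norm_exp_yosida_le hc0 hs) ht v
  have h2 : ‖yosida R c v‖ * t ≤ ε / 4 := by
    calc _ ≤ (‖w‖ + 1) * (ε / (4 * (‖w‖ + 1))) :=
          mul_le_mul hc.le htd ht (by positivity)
      _ = ε / 4 := by field_simp
  have h3 := hR.norm_exp_yosida_le hc0 ht (u - v)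
  have e : NormedSpace.exp (t • yosida R c) u - u = NormedSpace.exp (t • yosida R c) (u - v)
      + (NormedSpace.exp (t • yosida R c) v - v) - (u - v) := by
    rw [map_sub]
    abel
  rw [e]
  have h4 := norm_sub_le (NormedSpace.exp (t • yosida R c) (u - v)
      + (NormedSpace.exp (t • yosida R c) v - v)) (u - v)
  have h5 := norm_add_le (NormedSpace.exp (t • yosida R c) (u - v))
    (NormedSpace.exp (t • yosida R c) v - v)
  linarith

/-- The Hille–Yosida generation theorem, for resolvent families: the semigroup is the strong
limit of the exponentials of the Yosida approximations. -/
theorem exists_semigroup : ∃ S : C0Semigroup X, S.IsContraction ∧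
    (∀ c, 0 < c → ∀ u, S.HasDeriv (R c u) (c • R c u - u)) ∧
    ∀ t, 0 ≤ t → ∀ u, Tendsto (fun c => NormedSpace.exp (t • yosida R c) u) atTop
      (𝓝 (S.toFun t u)) := by
  have hex : ∀ t : ℝ, ∃ F : X →L[ℝ] X, 0 ≤ t →
      ∀ u, Tendsto (fun c => NormedSpace.exp (t • yosida R c) u) atTop (𝓝 (F u)) := by
    intro t
    by_cases ht : 0 ≤ t
    · choose f hf using hR.exists_tendsto_exp ht
      exact ⟨continuousLinearMapOfTendsto (fun c => NormedSpace.exp (t • yosida R c))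
        (tendsto_pi_nhds.2 hf), fun _ u => hf u⟩
    · exact ⟨0, fun h => absurd h ht⟩
  choose S hS using hex
  have hcontr : ∀ t : ℝ, 0 ≤ t → ∀ u : X, ‖S t u‖ ≤ ‖u‖ := by
    intro t ht u
    refine le_of_tendsto (hS t ht u).norm ?_
    filter_upwards [eventually_gt_atTop 0] with c hc
    exact hR.norm_exp_yosida_le hc ht u
  have hclose : ∀ u : X, ∀ ε > 0, ∃ δ > 0, ∀ t, 0 ≤ t → t ≤ δ → ‖S t u - u‖ ≤ ε := by
    intro u ε hε
    obtain ⟨δ, hδ, h⟩ := hR.eventually_norm_exp_sub_le u hε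
    refine ⟨δ, hδ, fun t ht htd => ?_⟩
    refine le_of_tendsto ((hS t ht u).sub_const u).norm ?_
    filter_upwards [h] with c hc
    exact hc t ht htd
  refine ⟨⟨S, ?_, ?_, ?_⟩, hcontr, ?_, hS⟩
  · ext u
    refine tendsto_nhds_unique (hS 0 le_rfl u) ?_
    simp
  · intro s t hs ht
    ext u
    refine tendsto_nhds_unique (hS (s + t) (add_nonneg hs ht) u) ?_
    rw [tendsto_iff_norm_sub_tendsto_zero]
    have h1 := tendsto_iff_norm_sub_tendsto_zero.1 (hS t ht u)
    have h2 := tendsto_iff_norm_sub_tendsto_zero.1 (hS s hs (S t u))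
    have h3 := h1.add h2
    rw [add_zero] at h3
    refine tendsto_of_tendsto_of_tendsto_of_le_of_le' tendsto_const_nhds h3
      (Eventually.of_forall fun _ => norm_nonneg _) ?_
    filter_upwards [eventually_gt_atTop 0] with c hc
    have e : NormedSpace.exp ((s + t) • yosida R c) u - (S s).comp (S t) u
        = NormedSpace.exp (s • yosida R c) (NormedSpace.exp (t • yosida R c) u - S t u)
          + (NormedSpace.exp (s • yosida R c) (S t u) - S s (S t u)) := by
      rw [exp_smul_add, map_sub]
      simp
    rw [e]
    exact (norm_add_le _ _).trans (add_le_add_left (hR.norm_exp_yosida_le hc hs _) _)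
  · intro u
    rw [Metric.tendsto_nhdsWithin_nhds]
    intro ε hε
    obtain ⟨δ, hδ, h⟩ := hclose u (ε / 2) (by positivity)
    refine ⟨δ, hδ, fun t ht htd => ?_⟩
    rw [dist_eq_norm]
    rw [Real.dist_0_eq_abs] at htd
    exact (h t ht ((le_abs_self t).trans htd.le)).trans_lt (by linarith)
  · intro d hd u
    have hA := hR.tendsto_yosida_res hd u
    set v := R d u
    set w := d • v - u
    change Tendsto (fun t : ℝ => t⁻¹ • (S t v - v)) (𝓝[>] 0) (𝓝 w)
    rw [Metric.tendsto_nhdsWithin_nhds]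
    intro ε hε
    obtain ⟨δ, hδ, h⟩ := hR.eventually_norm_exp_sub_le w (ε := ε / 4) (by positivity)
    refine ⟨δ, hδ, fun t ht htd => ?_⟩
    have ht : 0 < t := ht
    rw [Real.dist_0_eq_abs, abs_of_pos ht] at htd
    -- the mean value bound for the Yosida exponentials passes to the limit
    have hkey : ‖S t v - v - t • w‖ ≤ 3 * ε / 4 * t := by
      refine le_of_tendsto (((hS t ht.le v).sub_const v).sub (hA.const_smul t)).norm ?_
      filter_upwards [h, eventually_gt_atTop 0, (tendsto_iff_norm_sub_tendsto_zero.1 hA).eventually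
        (gt_mem_nhds (show (0 : ℝ) < ε / 4 by positivity))] with c hc hc0 hcw
      refine norm_exp_sub_sub_le ht.le v fun s hs => ?_
      have h1 := hc s hs.1 (hs.2.trans htd.le)
      have h2 := hR.norm_exp_yosida_le hc0 hs.1 (yosida R c v - w)
      have e : NormedSpace.exp (s • yosida R c) (yosida R c v) - yosida R c v
          = NormedSpace.exp (s • yosida R c) (yosida R c v - w)
            + (NormedSpace.exp (s • yosida R c) w - w) - (yosida R c v - w) := by
        rw [map_sub]
        abel
      rw [e]
      have h4 := norm_sub_le (NormedSpace.exp (s • yosida R c) (yosida R c v - w)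
        + (NormedSpace.exp (s • yosida R c) w - w)) (yosida R c v - w)
      have h5 := norm_add_le (NormedSpace.exp (s • yosida R c) (yosida R c v - w))
        (NormedSpace.exp (s • yosida R c) w - w)
      linarith
    rw [dist_eq_norm]
    have e : t⁻¹ • (S t v - v) - w = t⁻¹ • (S t v - v - t • w) := by
      rw [smul_sub t⁻¹ _ (t • w), inv_smul_smul₀ ht.ne']
    rw [e, norm_smul, Real.norm_of_nonneg (by positivity)]
    calc t⁻¹ * ‖S t v - v - t • w‖ ≤ t⁻¹ * (3 * ε / 4 * t) :=
          mul_le_mul_of_nonneg_left hkey (by positivity)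
      _ = 3 * ε / 4 := by field_simp
      _ < ε := by linarith

end IsContractionResolvent

end HilleYosida

/-! ### Abstract state spaces -/

section StateSpace

/-- An abstract state space: an ordered Banach space with closed generating cone on which the
norm is additive, where every vector is the difference of two positive ones with
`‖u‖ = ‖p‖ + ‖n‖`. -/
class IsStateSpace (X : Type*) [NormedAddCommGroup X] [NormedSpace ℝ X] [PartialOrder X] : Prop
    extends IsOrderedAddMonoid X, IsOrderedModule ℝ X, OrderClosedTopology X, CompleteSpace X where
  norm_add_of_nonneg : ∀ u v : X, 0 ≤ u → 0 ≤ v → ‖u + v‖ = ‖u‖ + ‖v‖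
  exists_sub : ∀ u : X, ∃ p n : X, 0 ≤ p ∧ 0 ≤ n ∧ u = p - n ∧ ‖u‖ = ‖p‖ + ‖n‖

variable {X : Type*} [NormedAddCommGroup X] [NormedSpace ℝ X] [PartialOrder X] [IsStateSpace X]

/-- An absolutely convergent iterated series may be summed along antidiagonals. -/
theorem hasSum_sum_antidiagonal {E : Type*} [NormedAddCommGroup E] [CompleteSpace E]
    (f : ℕ × ℕ → E) (h1 : ∀ j, Summable fun i => ‖f (j, i)‖)
    (h2 : Summable fun j => ∑' i, ‖f (j, i)‖) {g : ℕ → E}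
    (hg : ∀ j, HasSum (fun i => f (j, i)) (g j)) {a : E} (ha : HasSum g a) :
    HasSum (fun n => ∑ p ∈ Finset.HasAntidiagonal.antidiagonal n, f p) a := by
  have hs : Summable fun p => ‖f p‖ :=
    (summable_prod_of_nonneg fun _ => norm_nonneg _).2 ⟨h1, h2⟩
  have h3 := hs.of_norm.hasSum
  rw [(h3.prod_fiberwise hg).unique ha,
    ← Finset.HasAntidiagonal.sigmaAntidiagonalEquivProd.hasSum_iff] at h3
  have h5 := h3.sigma fun n => hasSum_fintype _
  convert h5 using 1
  funext n
  exact (Finset.sum_coe_sort (Finset.HasAntidiagonal.antidiagonal n) f).symm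

theorem norm_sub_of_le {u v : X} (hu : 0 ≤ u) (h : u ≤ v) : ‖v - u‖ = ‖v‖ - ‖u‖ := by
  have := IsStateSpace.norm_add_of_nonneg u (v - u) hu (sub_nonneg.2 h)
  rw [add_sub_cancel] at this
  linarith

/-- The norm of a linear map is determined on the cone. -/
theorem norm_le_of_cone {E : Type*} [NormedAddCommGroup E] [NormedSpace ℝ E] (F : X →ₗ[ℝ] E)
    {C : ℝ} (h : ∀ u, 0 ≤ u → ‖F u‖ ≤ C * ‖u‖) (u : X) : ‖F u‖ ≤ C * ‖u‖ := by
  obtain ⟨p, n, hp, hn, rfl, e⟩ := IsStateSpace.exists_sub u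
  rw [e, map_sub]
  linarith [norm_sub_le (F p) (F n), h p hp, h n hn, mul_add C ‖p‖ ‖n‖]

theorem IsSubstochastic.isContraction {T : C0Semigroup X} (hT : IsSubstochastic T) :
    T.IsContraction := by
  intro t ht u
  have := norm_le_of_cone (T.toFun t : X →ₗ[ℝ] X) (C := 1)
    (fun u hu => by rw [one_mul]; exact (hT t ht u hu).2) u
  rwa [one_mul] at this

theorem IsSubstochastic.res_nonneg {T : C0Semigroup X} (hT : IsSubstochastic T) {c : ℝ}
    (hc : 0 < c) {u : X} (hu : 0 ≤ u) : 0 ≤ T.res c u :=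
  hT.isContraction.res_nonneg hc fun t ht => (hT t ht u hu).1

end StateSpace

/-! ### Kato's perturbation series -/

section Kato

variable {X : Type*} [NormedAddCommGroup X] [NormedSpace ℝ X] [PartialOrder X]

/-- The hypotheses of Kato's generation theorem: `U` is substochastic with generator `A`, the
perturbation `B` is positive on the domain of `A`, and `⟨Ψ, A v + B v⟩ ≤ 0` for positive `v` in the
domain, where the functional `Ψ` is the norm on the cone. -/
structure IsKatoPerturbation (Ψ : X →L[ℝ] ℝ) (U : C0Semigroup X)
    (B : U.generator.domain →ₗ[ℝ] X) : Prop where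
  Psi_eq : ∀ u, 0 ≤ u → Ψ u = ‖u‖
  substochastic : IsSubstochastic U
  nonneg : ∀ v : U.generator.domain, 0 ≤ (v : X) → 0 ≤ B v
  Psi_le : ∀ v : U.generator.domain, 0 ≤ (v : X) → Ψ (U.generator v + B v) ≤ 0

/-- The operator `B (c - A)⁻¹` as a bounded operator (`0` should it fail to be one). -/
noncomputable def katoOp (U : C0Semigroup X) (B : U.generator.domain →ₗ[ℝ] X) (c : ℝ) :
    X →L[ℝ] X :=
  open scoped Classical in
  if h : ∃ F : X →L[ℝ] X, ∀ u, F u = perturbResolvent U.generator B c u then h.choose else 0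

/-- The sum `∑ₙ (c - A)⁻¹ [B (c - A)⁻¹]ⁿ` as a bounded operator (`0` should it fail to be one). -/
noncomputable def katoRes (U : C0Semigroup X) (B : U.generator.domain →ₗ[ℝ] X) (c : ℝ) :
    X →L[ℝ] X :=
  open scoped Classical in
  if h : ∃ F : X →L[ℝ] X, ∀ u, HasSum (fun n => U.res c ((katoOp U B c ^ n) u)) (F u)
    then h.choose else 0

namespace IsKatoPerturbation

variable [IsStateSpace X] {Ψ : X →L[ℝ] ℝ} {U : C0Semigroup X} {B : U.generator.domain →ₗ[ℝ] X}
  (h : IsKatoPerturbation Ψ U B)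
include h

theorem isContraction : U.IsContraction := h.substochastic.isContraction

/-- The inequality `⟨Ψ, A v + B v⟩ ≤ 0` at `v = (c - A)⁻¹ u`. -/
theorem norm_perturbResolvent_le {c : ℝ} (hc : 0 < c) {u : X} (hu : 0 ≤ u) :
    0 ≤ perturbResolvent U.generator B c u ∧
      ‖perturbResolvent U.generator B c u‖ + c * ‖U.res c u‖ ≤ ‖u‖ := by
  have hR := h.substochastic.res_nonneg hc hu
  rw [perturbResolvent, h.isContraction.resolvent_eq hc]
  have hd := h.isContraction.hasDeriv_res hc u
  have h1 := h.nonneg ⟨U.res c u, hd.mem_domain⟩ hR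
  have h2 := h.Psi_le ⟨U.res c u, hd.mem_domain⟩ hR
  refine ⟨h1, ?_⟩
  rw [hd.generator_eq, map_add, map_sub, map_smul, h.Psi_eq _ h1, h.Psi_eq _ hR, h.Psi_eq _ hu,
    smul_eq_mul] at h2
  linarith

theorem katoOp_apply {c : ℝ} (hc : 0 < c) (u : X) :
    katoOp U B c u = perturbResolvent U.generator B c u := by
  have hex : ∃ F : X →L[ℝ] X, ∀ u, F u = perturbResolvent U.generator B c u := by
    let F : X →ₗ[ℝ] X := B.comp ((U.res c : X →ₗ[ℝ] X).codRestrict U.generator.domain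
      fun u => (h.isContraction.hasDeriv_res hc u).mem_domain)
    have hF : ∀ u, F u = perturbResolvent U.generator B c u := by
      intro u
      rw [perturbResolvent, h.isContraction.resolvent_eq hc]
      rfl
    refine ⟨F.mkContinuous 1 (norm_le_of_cone F fun u hu => ?_), hF⟩
    rw [hF, one_mul]
    have := (h.norm_perturbResolvent_le hc hu).2
    linarith [mul_nonneg hc.le (norm_nonneg (U.res c u))]
  rw [katoOp, dif_pos hex]
  exact hex.choose_spec u

theorem katoOp_eq {c : ℝ} (hc : 0 < c) (u : X) : katoOp U B c u
    = B ⟨U.res c u, (h.isContraction.hasDeriv_res hc u).mem_domain⟩ := by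
  rw [h.katoOp_apply hc, perturbResolvent, h.isContraction.resolvent_eq hc]

theorem katoOp_pow_apply {c : ℝ} (hc : 0 < c) (n : ℕ) (u : X) :
    (perturbResolvent U.generator B c)^[n] u = (katoOp U B c ^ n) u := by
  induction n with
  | zero => rfl
  | succ n ih => rw [Function.iterate_succ_apply', ih, pow_succ', mul_apply_eq_comp,
      h.katoOp_apply hc]

theorem katoOp_nonneg {c : ℝ} (hc : 0 < c) {u : X} (hu : 0 ≤ u) : 0 ≤ katoOp U B c u := by
  rw [h.katoOp_apply hc]
  exact (h.norm_perturbResolvent_le hc hu).1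

theorem katoOp_pow_nonneg {c : ℝ} (hc : 0 < c) {u : X} (hu : 0 ≤ u) (n : ℕ) :
    0 ≤ (katoOp U B c ^ n) u := by
  induction n with
  | zero => exact hu
  | succ n ih =>
    rw [pow_succ', mul_apply_eq_comp]
    exact h.katoOp_nonneg hc ih

theorem norm_katoOp_add_le {c : ℝ} (hc : 0 < c) {u : X} (hu : 0 ≤ u) :
    ‖katoOp U B c u‖ + c * ‖U.res c u‖ ≤ ‖u‖ := by
  rw [h.katoOp_apply hc]
  exact (h.norm_perturbResolvent_le hc hu).2

theorem sum_norm_le {c : ℝ} (hc : 0 < c) {u : X} (hu : 0 ≤ u) (N : ℕ) :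
    ‖(katoOp U B c ^ N) u‖ + c * ∑ n ∈ Finset.range N, ‖U.res c ((katoOp U B c ^ n) u)‖
      ≤ ‖u‖ := by
  induction N with
  | zero => simp
  | succ N ih =>
    have := h.norm_katoOp_add_le hc (h.katoOp_pow_nonneg hc hu N)
    rw [Finset.sum_range_succ, pow_succ', mul_apply_eq_comp, mul_add]
    linarith

theorem sum_norm_le' {c : ℝ} (hc : 0 < c) {u : X} (hu : 0 ≤ u) (N : ℕ) :
    ∑ n ∈ Finset.range N, ‖U.res c ((katoOp U B c ^ n) u)‖ ≤ c⁻¹ * ‖u‖ := by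
  rw [← div_eq_inv_mul, le_div_iff₀' hc]
  linarith [h.sum_norm_le hc hu N, norm_nonneg ((katoOp U B c ^ N) u)]

theorem summable_norm {c : ℝ} (hc : 0 < c) {u : X} (hu : 0 ≤ u) :
    Summable fun n => ‖U.res c ((katoOp U B c ^ n) u)‖ :=
  summable_of_sum_range_le (fun _ => norm_nonneg _) (h.sum_norm_le' hc hu)

theorem tsum_norm_le {c : ℝ} (hc : 0 < c) {u : X} (hu : 0 ≤ u) :
    ∑' n, ‖U.res c ((katoOp U B c ^ n) u)‖ ≤ c⁻¹ * ‖u‖ :=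
  Real.tsum_le_of_sum_range_le (fun _ => norm_nonneg _) (h.sum_norm_le' hc hu)

theorem hasSum_katoRes {c : ℝ} (hc : 0 < c) (u : X) :
    HasSum (fun n => U.res c ((katoOp U B c ^ n) u)) (katoRes U B c u) := by
  have hs : ∀ u, Summable fun n => U.res c ((katoOp U B c ^ n) u) := by
    intro u
    obtain ⟨p, n, hp, hn, rfl, -⟩ := IsStateSpace.exists_sub u
    simp_rw [map_sub]
    exact (h.summable_norm hc hp).of_norm.sub (h.summable_norm hc hn).of_norm
  have hex : ∃ F : X →L[ℝ] X, ∀ u, HasSum (fun n => U.res c ((katoOp U B c ^ n) u)) (F u) := by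
    let F : X →ₗ[ℝ] X :=
      { toFun := fun u => ∑' n, U.res c ((katoOp U B c ^ n) u)
        map_add' := fun u v => by
          rw [← (hs u).tsum_add (hs v)]
          simp
        map_smul' := fun a u => by
          rw [RingHom.id_apply, ← (hs u).tsum_const_smul a]
          simp }
    refine ⟨F.mkContinuous c⁻¹ (norm_le_of_cone F fun u hu => ?_), fun u => (hs u).hasSum⟩
    exact (norm_tsum_le_tsum_norm (h.summable_norm hc hu)).trans (h.tsum_norm_le hc hu)
  rw [katoRes, dif_pos hex]
  exact hex.choose_spec u

theorem katoRes_nonneg {c : ℝ} (hc : 0 < c) {u : X} (hu : 0 ≤ u) : 0 ≤ katoRes U B c u :=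
  (h.hasSum_katoRes hc u).nonneg fun n =>
    h.substochastic.res_nonneg hc (h.katoOp_pow_nonneg hc hu n)

theorem norm_katoRes_le {c : ℝ} (hc : 0 < c) (u : X) : ‖katoRes U B c u‖ ≤ c⁻¹ * ‖u‖ := by
  refine norm_le_of_cone (katoRes U B c : X →ₗ[ℝ] X) (fun u hu => ?_) u
  change ‖katoRes U B c u‖ ≤ _
  rw [← (h.hasSum_katoRes hc u).tsum_eq]
  exact (norm_tsum_le_tsum_norm (h.summable_norm hc hu)).trans (h.tsum_norm_le hc hu)

theorem katoRes_eq {c : ℝ} (hc : 0 < c) (u : X) :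
    katoRes U B c u = U.res c u + katoRes U B c (katoOp U B c u) := by
  have h1 := h.hasSum_katoRes hc u
  have h2 := h.hasSum_katoRes hc (katoOp U B c u)
  have h3 : HasSum (fun n => U.res c ((katoOp U B c ^ (n + 1)) u))
      (katoRes U B c (katoOp U B c u)) := by
    simpa only [pow_succ, mul_apply_eq_comp] using h2
  have h4 := (hasSum_nat_add_iff (f := fun n => U.res c ((katoOp U B c ^ n) u)) 1).1 h3
  rw [Finset.sum_range_one, pow_zero, one_apply_eq_self] at h4
  rw [h1.unique h4, add_comm]

theorem katoOp_sub_katoOp {c d : ℝ} (hc : 0 < c) (hd : 0 < d) (u : X) :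
    katoOp U B c u - katoOp U B d u = (d - c) • katoOp U B c (U.res d u) := by
  rw [h.katoOp_eq hc, h.katoOp_eq hd, h.katoOp_eq hc, ← map_sub]
  exact (congrArg B (Subtype.ext (h.isContraction.res_sub_res hc hd u))).trans (map_smul B _ _)

/-- The resolvent identity for the terms of the perturbation series. -/
theorem term_sub_term {c d : ℝ} (hc : 0 < c) (hd : 0 < d) (n : ℕ) (u : X) :
    U.res c ((katoOp U B c ^ n) u) - U.res d ((katoOp U B d ^ n) u)
      = (d - c) • ∑ p ∈ Finset.HasAntidiagonal.antidiagonal n,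
          U.res c ((katoOp U B c ^ p.2) (U.res d ((katoOp U B d ^ p.1) u))) := by
  induction n generalizing u with
  | zero => simpa using h.isContraction.res_sub_res hc hd u
  | succ n ih =>
    rw [Finset.Nat.sum_antidiagonal_succ]
    simp only [pow_succ, mul_apply_eq_comp, pow_zero, one_apply_eq_self]
    rw [smul_add, ← ih (katoOp U B d u), ← map_smul, ← map_smul, ← h.katoOp_sub_katoOp hc hd,
      map_sub, map_sub]
    abel

theorem katoRes_sub_katoRes {c d : ℝ} (hc : 0 < c) (hd : 0 < d) (u : X) :
    katoRes U B c u - katoRes U B d u = (d - c) • katoRes U B c (katoRes U B d u) := by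
  have key : ∀ u, 0 ≤ u →
      katoRes U B c u - katoRes U B d u = (d - c) • katoRes U B c (katoRes U B d u) := by
    intro u hu
    obtain ⟨w, hw⟩ : ∃ w : ℕ → X, ∀ j, w j = U.res d ((katoOp U B d ^ j) u) := ⟨_, fun _ => rfl⟩
    have hw0 : ∀ j, 0 ≤ w j := fun j => by
      rw [hw]
      exact h.substochastic.res_nonneg hd (h.katoOp_pow_nonneg hd hu j)
    have hwn : Summable fun j => ‖w j‖ := by
      simp_rw [hw]
      exact h.summable_norm hd hu
    have hws : HasSum w (katoRes U B d u) := by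
      rw [funext hw]
      exact h.hasSum_katoRes hd u
    obtain ⟨f, hf⟩ : ∃ f : ℕ × ℕ → X, ∀ j i, f (j, i) = U.res c ((katoOp U B c ^ i) (w j)) :=
      ⟨fun p => U.res c ((katoOp U B c ^ p.2) (w p.1)), fun _ _ => rfl⟩
    have hf1 : ∀ j, Summable fun i => ‖f (j, i)‖ := fun j => by
      simp_rw [hf]
      exact h.summable_norm hc (hw0 j)
    have hf2 : Summable fun j => ∑' i, ‖f (j, i)‖ := by
      refine Summable.of_nonneg_of_le (fun j => tsum_nonneg fun _ => norm_nonneg _)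
        (fun j => ?_) (hwn.mul_left c⁻¹)
      simp_rw [hf]
      exact h.tsum_norm_le hc (hw0 j)
    have hf3 : ∀ j, HasSum (fun i => f (j, i)) (katoRes U B c (w j)) := fun j => by
      simp_rw [hf]
      exact h.hasSum_katoRes hc (w j)
    have h1 := hasSum_sum_antidiagonal f hf1 hf2 hf3 (hws.mapL (katoRes U B c))
    refine ((h.hasSum_katoRes hc u).sub (h.hasSum_katoRes hd u)).unique ?_
    convert h1.const_smul (d - c) using 2 with n
    rw [h.term_sub_term hc hd]
    congr 1
    refine Finset.sum_congr rfl fun p _ => ?_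
    rw [← hw, ← hf]
  obtain ⟨p, n, hp, hn, rfl, -⟩ := IsStateSpace.exists_sub u
  have h1 := key p hp
  have h2 := key n hn
  simp only [map_sub, smul_sub]
  rw [← h1, ← h2]
  abel

/-- The perturbation series dominates `(c - A)⁻¹` on the cone and is bounded by `c⁻¹`; as the norm
is additive there, the strong convergence of `c (c - A)⁻¹` carries over. -/
theorem tendsto_smul_katoRes (u : X) :
    Tendsto (fun c => c • katoRes U B c u) atTop (𝓝 u) := by
  have key : ∀ u, 0 ≤ u → Tendsto (fun c => c • katoRes U B c u) atTop (𝓝 u) := by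
    intro u hu
    have h0 := h.isContraction.tendsto_smul_res u
    have h1 : Tendsto (fun c : ℝ => c • katoRes U B c u - c • U.res c u) atTop (𝓝 0) := by
      have h2 : Tendsto (fun c : ℝ => ‖u‖ - ‖c • U.res c u‖) atTop (𝓝 0) := by
        have := h0.norm.const_sub ‖u‖
        rwa [sub_self] at this
      refine squeeze_zero_norm' ?_ h2
      filter_upwards [eventually_gt_atTop 0] with c hc
      have h3 : c • U.res c u ≤ c • katoRes U B c u := by
        rw [h.katoRes_eq hc u, smul_add]
        exact le_add_of_nonneg_right
          (smul_nonneg hc.le (h.katoRes_nonneg hc (h.katoOp_nonneg hc hu)))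
      rw [norm_sub_of_le (smul_nonneg hc.le (h.substochastic.res_nonneg hc hu)) h3]
      have h4 := h.norm_katoRes_le hc u
      have h5 : ‖c • katoRes U B c u‖ ≤ ‖u‖ := by
        rw [norm_smul, Real.norm_of_nonneg hc.le]
        calc c * ‖katoRes U B c u‖ ≤ c * (c⁻¹ * ‖u‖) := mul_le_mul_of_nonneg_left h4 hc.le
          _ = ‖u‖ := by field_simp
      linarith
    have h6 := h1.add h0
    simpa using h6
  obtain ⟨p, n, hp, hn, rfl, -⟩ := IsStateSpace.exists_sub u
  simp_rw [map_sub, smul_sub]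
  exact (key p hp).sub (key n hn)

theorem isContractionResolvent : IsContractionResolvent (katoRes U B) where
  norm_le _ hc := h.norm_katoRes_le hc
  sub_eq _ _ hc hd := h.katoRes_sub_katoRes hc hd
  tendsto := h.tendsto_smul_katoRes

/-- Kato's generation theorem: a substochastic semigroup whose generator extends `A + B` and
whose resolvent is the perturbation series. -/
theorem exists_kato_semigroup : ∃ S : C0Semigroup X, IsSubstochastic S ∧
    perturb U.generator B ≤ S.generator ∧ ∀ c, 0 < c → S.res c = katoRes U B c := by
  obtain ⟨S, hS, hd, hlim⟩ := h.isContractionResolvent.exists_semigroup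
  refine ⟨S, fun t ht u hu => ⟨?_, hS t ht u⟩, ?_, fun c hc => ?_⟩
  · refine ge_of_tendsto (hlim t ht u) ?_
    filter_upwards [eventually_gt_atTop 0] with c hc
    exact exp_yosida_nonneg (fun u hu => h.katoRes_nonneg hc hu) ht hu
  · have key : ∀ v : U.generator.domain, S.HasDeriv (v : X) (U.generator v + B v) := by
      intro v
      have h1 := C0Semigroup.hasDeriv_generator v
      have h2 := h.isContraction.res_eq one_pos h1
      have h3 := h.katoRes_eq one_pos ((1 : ℝ) • (v : X) - U.generator v)
      have h4 : katoOp U B 1 ((1 : ℝ) • (v : X) - U.generator v) = B v := by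
        rw [h.katoOp_eq one_pos]
        exact congrArg B (Subtype.ext h2)
      rw [h2, h4, ← sub_eq_iff_eq_add, ← map_sub] at h3
      have h5 := hd 1 one_pos ((1 : ℝ) • (v : X) - U.generator v - B v)
      rw [h3] at h5
      have e : (1 : ℝ) • (v : X) - ((1 : ℝ) • (v : X) - U.generator v - B v)
        = U.generator v + B v := by abel
      rwa [e] at h5
    refine ⟨fun v hv => (key ⟨v, hv⟩).mem_domain, fun x y hxy => ?_⟩
    have h1 := key x
    rw [show ((x : U.generator.domain) : X) = (y : X) from hxy] at h1
    exact h1.unique (C0Semigroup.hasDeriv_generator y)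
  · ext u
    have := hS.res_eq hc (hd c hc u)
    rwa [sub_sub_cancel] at this

variable {V : C0Semigroup X}

/-- `(c - G)⁻¹ (c - A - B) v = v` for `v = (c - A)⁻¹ u`, where `G` extends `A + B`. -/
theorem res_sub_katoOp (hV : IsSubstochastic V) (hext : perturb U.generator B ≤ V.generator)
    {c : ℝ} (hc : 0 < c) (u : X) : V.res c (u - katoOp U B c u) = U.res c u := by
  have hd := h.isContraction.hasDeriv_res hc u
  have h1 := hext.2 (x := ⟨U.res c u, hd.mem_domain⟩)
    (y := ⟨U.res c u, hext.1 hd.mem_domain⟩) rfl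
  have h2 : V.HasDeriv (U.res c u) (c • U.res c u - u + katoOp U B c u) := by
    have h3 := C0Semigroup.hasDeriv_generator (T := V) ⟨U.res c u, hext.1 hd.mem_domain⟩
    rw [← h1] at h3
    have h4 : perturb U.generator B ⟨U.res c u, hd.mem_domain⟩
        = c • U.res c u - u + katoOp U B c u := by
      rw [h.katoOp_eq hc]
      exact congrArg (· + B ⟨U.res c u, hd.mem_domain⟩) hd.generator_eq
    rwa [h4] at h3
  have h5 := hV.isContraction.res_eq hc h2
  rw [← h5]
  congr 1
  abel

theorem res_sub_katoOp_pow (hV : IsSubstochastic V) (hext : perturb U.generator B ≤ V.generator)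
    {c : ℝ} (hc : 0 < c) (u : X) (N : ℕ) : V.res c (u - (katoOp U B c ^ N) u)
      = ∑ n ∈ Finset.range N, U.res c ((katoOp U B c ^ n) u) := by
  induction N with
  | zero => simp
  | succ N ih =>
    rw [Finset.sum_range_succ, ← ih, ← h.res_sub_katoOp hV hext hc, ← map_add, pow_succ',
      mul_apply_eq_comp]
    congr 1
    abel

/-- The resolvent of the minimal semigroup is the perturbation series. -/
theorem res_eq_katoRes (hV : IsMinimalSemigroup U.generator B V) {c : ℝ} (hc : 0 < c) :
    V.res c = katoRes U B c := by
  have key : ∀ u, 0 ≤ u → V.res c u = katoRes U B c u := by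
    intro u hu
    apply le_antisymm
    · obtain ⟨S, hS, hext, hres⟩ := h.exists_kato_semigroup
      rw [← hres c hc]
      exact hV.substochastic.isContraction.res_mono hS.isContraction hc
        fun t ht => hV.minimal S hS hext t ht u hu
    · refine le_of_tendsto' (h.hasSum_katoRes hc u).tendsto_sum_nat fun N => ?_
      rw [← h.res_sub_katoOp_pow hV.substochastic hV.extends_perturb hc, map_sub]
      exact sub_le_self _ (hV.substochastic.res_nonneg hc (h.katoOp_pow_nonneg hc hu N))
  ext u
  obtain ⟨p, n, hp, hn, rfl, -⟩ := IsStateSpace.exists_sub u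
  rw [map_sub, map_sub, key p hp, key n hn]

/-! ### The defect functionals -/

theorem Xi_eq (hV : IsMinimalSemigroup U.generator B V) {c : ℝ} (hc : 0 < c) (u : X) :
    Xi Ψ U.generator B V.generator c u = Ψ u - c * Ψ (V.res c u)
      - ∑' n, (Ψ ((katoOp U B c ^ n) u) - Ψ ((katoOp U B c ^ (n + 1)) u)
        - c * Ψ (U.res c ((katoOp U B c ^ n) u))) := by
  have hVc := hV.substochastic.isContraction
  rw [Xi, hVc.resolvent_eq hc, aZero, aBar, (hVc.hasDeriv_res hc u).generator_eq]
  congr 1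
  · rw [map_sub, map_smul, smul_eq_mul]
    ring
  · refine tsum_congr fun n => ?_
    rw [sub_sub_cancel, h.katoOp_pow_apply hc, h.isContraction.resolvent_eq hc, aFun,
      (h.isContraction.hasDeriv_res hc _).generator_eq, ← h.katoOp_eq hc, pow_succ',
      mul_apply_eq_comp, map_add, map_sub, map_smul, smul_eq_mul]
    ring

/-- The series in the definition of `Ξ_c` telescopes, and its remaining part is accounted for by
`res_eq_katoRes`. -/
theorem tendsto_Xi (hV : IsMinimalSemigroup U.generator B V) {c : ℝ} (hc : 0 < c) (u : X) :
    Tendsto (fun N => Ψ ((katoOp U B c ^ N) u)) atTop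
      (𝓝 (Xi Ψ U.generator B V.generator c u)) := by
  set f : X → ℕ → ℝ := fun u n => Ψ ((katoOp U B c ^ n) u) - Ψ ((katoOp U B c ^ (n + 1)) u)
        - c * Ψ (U.res c ((katoOp U B c ^ n) u)) with hf
  have hsum : ∀ u N, ∑ n ∈ Finset.range N, f u n = Ψ u - Ψ ((katoOp U B c ^ N) u)
      - c * Ψ (∑ n ∈ Finset.range N, U.res c ((katoOp U B c ^ n) u)) := by
    intro u N
    induction N with
    | zero => simp
    | succ N ih =>
      rw [Finset.sum_range_succ, ih, Finset.sum_range_succ, map_add]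
      simp only [hf]
      ring
  have hs1 : ∀ u, 0 ≤ u → Summable (f u) := by
    intro u hu
    refine summable_of_sum_range_le (c := ‖u‖) (fun n => ?_) fun N => ?_
    · have hn := h.katoOp_pow_nonneg hc hu n
      have h1 := h.norm_katoOp_add_le hc hn
      simp only [hf]
      rw [h.Psi_eq _ hn, h.Psi_eq _ (h.katoOp_pow_nonneg hc hu (n + 1)),
        h.Psi_eq _ (h.substochastic.res_nonneg hc hn), pow_succ', mul_apply_eq_comp]
      linarith
    · have h2 : 0 ≤ ∑ n ∈ Finset.range N, U.res c ((katoOp U B c ^ n) u) :=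
        Finset.sum_nonneg fun n _ =>
          h.substochastic.res_nonneg hc (h.katoOp_pow_nonneg hc hu n)
      rw [hsum, h.Psi_eq _ hu, h.Psi_eq _ (h.katoOp_pow_nonneg hc hu N), h.Psi_eq _ h2]
      have := mul_nonneg hc.le (norm_nonneg
        (∑ n ∈ Finset.range N, U.res c ((katoOp U B c ^ n) u)))
      linarith [norm_nonneg ((katoOp U B c ^ N) u)]
  have hs : Summable (f u) := by
    obtain ⟨p, n, hp, hn, rfl, -⟩ := IsStateSpace.exists_sub u
    refine ((hs1 p hp).sub (hs1 n hn)).congr fun k => ?_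
    simp only [hf, map_sub]
    ring
  have h1 := hs.hasSum.tendsto_sum_nat
  have h2 := (Ψ.continuous.tendsto _).comp (h.hasSum_katoRes hc u).tendsto_sum_nat
  have h3 := ((h2.const_mul c).const_sub (Ψ u)).sub h1
  rw [h.Xi_eq hV hc, h.res_eq_katoRes hV hc]
  refine h3.congr fun N => ?_
  rw [hsum]
  simp only [Function.comp_apply]
  ring

/-- The functional `Ξ_c` is the strong limit of `Ψ ∘ [B (c - A)⁻¹]ᴺ`, hence bounded and linear. -/
theorem exists_xi (hV : IsMinimalSemigroup U.generator B V) {c : ℝ} (hc : 0 < c) :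
    ∃ ξ : X →L[ℝ] ℝ, ∀ u, ξ u = Xi Ψ U.generator B V.generator c u :=
  ⟨continuousLinearMapOfTendsto (fun N => Ψ.comp (katoOp U B c ^ N))
    (tendsto_pi_nhds.2 (h.tendsto_Xi hV hc)), fun _ => rfl⟩

theorem Xi_nonneg (hV : IsMinimalSemigroup U.generator B V) {c : ℝ} (hc : 0 < c) {u : X}
    (hu : 0 ≤ u) : 0 ≤ Xi Ψ U.generator B V.generator c u := by
  refine ge_of_tendsto' (h.tendsto_Xi hV hc u) fun N => ?_
  rw [h.Psi_eq _ (h.katoOp_pow_nonneg hc hu N)]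
  exact norm_nonneg _

theorem Xi_le (hV : IsMinimalSemigroup U.generator B V) {c : ℝ} (hc : 0 < c) {u : X}
    (hu : 0 ≤ u) : Xi Ψ U.generator B V.generator c u ≤ ‖u‖ := by
  refine le_of_tendsto' (h.tendsto_Xi hV hc u) fun N => ?_
  rw [h.Psi_eq _ (h.katoOp_pow_nonneg hc hu N)]
  refine le_trans ?_ (h.sum_norm_le hc hu N)
  exact le_add_of_nonneg_right (mul_nonneg hc.le (Finset.sum_nonneg fun _ _ => norm_nonneg _))

theorem Xi_sub_katoOp (hV : IsMinimalSemigroup U.generator B V) {c : ℝ} (hc : 0 < c) (u : X) :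
    Xi Ψ U.generator B V.generator c (u - katoOp U B c u) = 0 := by
  have h1 := h.tendsto_Xi hV hc u
  have h2 := h1.sub ((tendsto_add_atTop_iff_nat 1).2 h1)
  rw [sub_self] at h2
  refine tendsto_nhds_unique (h.tendsto_Xi hV hc _) (h2.congr fun N => ?_)
  rw [pow_succ, mul_apply_eq_comp, map_sub, map_sub]

/-- The functional `Ξ_d` vanishes on `(d - A - B) v` for `v` in the domain of `A`; here
`v = (c - A)⁻¹ u`. -/
theorem Xi_res (hV : IsMinimalSemigroup U.generator B V) {c d : ℝ} (hc : 0 < c) (hd : 0 < d)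
    (u : X) : Xi Ψ U.generator B V.generator d
      ((d - c) • U.res c u + (u - katoOp U B c u)) = 0 := by
  have hD := h.isContraction.hasDeriv_res hc u
  have h1 := h.isContraction.res_eq hd hD
  have h2 := h.Xi_sub_katoOp hV hd (d • U.res c u - (c • U.res c u - u))
  have h3 : katoOp U B d (d • U.res c u - (c • U.res c u - u)) = katoOp U B c u := by
    rw [h.katoOp_eq hd, h.katoOp_eq hc]
    exact congrArg B (Subtype.ext h1)
  rw [h3] at h2
  rw [← h2]
  congr 1
  module

/-- Apply `Ξ_d` to `(d - A - B) v` for partial sums `v` of the perturbation series at `c`, and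
let the remainder `[B (c - A)⁻¹]ᴺ u` be estimated by `Ψ`. -/
theorem Xi_add_le (hV : IsMinimalSemigroup U.generator B V) {c d : ℝ} (hc : 0 < c) (hd : 0 < d)
    {u : X} (hu : 0 ≤ u) : Xi Ψ U.generator B V.generator d (u + (d - c) • V.res c u)
      ≤ Xi Ψ U.generator B V.generator c u := by
  obtain ⟨ξ, hξ⟩ := h.exists_xi hV hd
  have h1 : ∀ N, ξ ((d - c) • (∑ n ∈ Finset.range N, U.res c ((katoOp U B c ^ n) u)) + u)
      = ξ ((katoOp U B c ^ N) u) := by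
    intro N
    induction N with
    | zero => simp
    | succ N ih =>
      have h2 := h.Xi_res hV hc hd ((katoOp U B c ^ N) u)
      rw [← hξ] at h2
      rw [Finset.sum_range_succ, pow_succ', mul_apply_eq_comp]
      simp only [map_add, map_sub, map_smul, smul_add] at h2 ih ⊢
      linarith
  rw [← hξ, h.res_eq_katoRes hV hc, add_comm]
  have h3 := (ξ.continuous.tendsto _).comp
    ((((h.hasSum_katoRes hc u).tendsto_sum_nat).const_smul (d - c)).add_const u)
  refine le_of_tendsto_of_tendsto' h3 (h.tendsto_Xi hV hc u) fun N => ?_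
  have hN := h.katoOp_pow_nonneg hc hu N
  simp only [Function.comp_apply]
  rw [h1, hξ, h.Psi_eq _ hN]
  exact h.Xi_le hV hd hN

/-- For `c < d` the operator `1 + (d - c) (c - G)⁻¹` is positive with inverse
`1 + (c - d) (d - G)⁻¹`, so the inequality `Xi_add_le` can be reversed. -/
theorem Xi_add_eq (hV : IsMinimalSemigroup U.generator B V) {c d : ℝ} (hc : 0 < c) (hcd : c < d)
    {u : X} (hu : 0 ≤ u) : Xi Ψ U.generator B V.generator d (u + (d - c) • V.res c u)
      = Xi Ψ U.generator B V.generator c u := by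
  have hd := hc.trans hcd
  refine le_antisymm (h.Xi_add_le hV hc hd hu) ?_
  have hv : 0 ≤ u + (d - c) • V.res c u := add_nonneg hu
    (smul_nonneg (sub_nonneg.2 hcd.le) (hV.substochastic.res_nonneg hc hu))
  have h1 := h.Xi_add_le hV hd hc hv
  have h2 := hV.substochastic.isContraction.res_sub_res hd hc u
  have e : u + (d - c) • V.res c u + (c - d) • V.res d (u + (d - c) • V.res c u) = u := by
    have h3 : V.res d (u + (d - c) • V.res c u) = V.res c u := by
      rw [map_add, map_smul, ← neg_sub c d, neg_smul, ← h2]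
      abel
    rw [h3]
    module
  rwa [e] at h1

/-- Whether a positive `u` is annihilated by `Ξ_c` does not depend on `c`: it is inherited by
larger parameters and by resolvents, and `(c - G)⁻¹` is a Neumann series in `(d - G)⁻¹`. -/
theorem Xi_eq_zero (hV : IsMinimalSemigroup U.generator B V) {c d : ℝ} (hc : 0 < c) (hd : 0 < d)
    {u : X} (hu : 0 ≤ u) (h0 : Xi Ψ U.generator B V.generator c u = 0) :
    Xi Ψ U.generator B V.generator d u = 0 := by
  have hVs := hV.substochastic
  have hadd : ∀ {c d : ℝ}, 0 < c → c < d → ∀ {u : X}, 0 ≤ u →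
      Xi Ψ U.generator B V.generator d u + (d - c) * Xi Ψ U.generator B V.generator d (V.res c u)
        = Xi Ψ U.generator B V.generator c u := by
    intro c d hc hcd u hu
    obtain ⟨ξ, hξ⟩ := h.exists_xi hV (hc.trans hcd)
    rw [← h.Xi_add_eq hV hc hcd hu]
    simp only [← hξ, map_add, map_smul, smul_eq_mul]
  -- both terms on the left of `hadd` are nonnegative
  have hup : ∀ {c d : ℝ}, 0 < c → c < d → ∀ {u : X}, 0 ≤ u →
      Xi Ψ U.generator B V.generator c u = 0 → Xi Ψ U.generator B V.generator d u = 0 ∧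
        Xi Ψ U.generator B V.generator d (V.res c u) = 0 := by
    intro c d hc hcd u hu h0
    have h1 := hadd hc hcd hu
    have h2 := h.Xi_nonneg hV (hc.trans hcd) hu
    have h3 := h.Xi_nonneg hV (hc.trans hcd) (hVs.res_nonneg hc hu)
    have h4 := mul_nonneg (sub_nonneg.2 hcd.le) h3
    have h5 : (d - c) * Xi Ψ U.generator B V.generator d (V.res c u) = 0 := by linarith
    exact ⟨by linarith, (mul_eq_zero.1 h5).resolve_left (sub_ne_zero.2 hcd.ne')⟩
  -- `Ξ_d ((d - G)⁻¹ u)` is `O(e - d)` as `e ↓ d`, by `hadd` and `hup` for the pair `d < e`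
  have hres : ∀ {d : ℝ}, 0 < d → ∀ {u : X}, 0 ≤ u →
      Xi Ψ U.generator B V.generator d u = 0 →
        Xi Ψ U.generator B V.generator d (V.res d u) = 0 := by
    intro d hd u hu h0
    have hw := hVs.res_nonneg hd hu
    refine le_antisymm ?_ (h.Xi_nonneg hV hd hw)
    have h1 : Tendsto (fun e : ℝ => (e - d) * ‖V.res d (V.res d u)‖) (𝓝[>] d) (𝓝 0) := by
      have : Tendsto (fun e : ℝ => (e - d) * ‖V.res d (V.res d u)‖) (𝓝 d)
          (𝓝 ((d - d) * ‖V.res d (V.res d u)‖)) :=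
        (tendsto_id.sub_const d).mul_const _
      rw [sub_self, zero_mul] at this
      exact this.mono_left nhdsWithin_le_nhds
    refine ge_of_tendsto h1 ?_
    filter_upwards [self_mem_nhdsWithin] with e he
    have he : d < e := he
    rw [← hadd hd he hw, (hup hd he hu h0).2, zero_add]
    exact mul_le_mul_of_nonneg_left (h.Xi_le hV (hd.trans he) (hVs.res_nonneg hd hw))
      (sub_nonneg.2 he.le)
  rcases lt_trichotomy c d with hcd | rfl | hdc
  · exact (hup hc hcd hu h0).1
  · exact h0
  · -- for `d < c`, iterate `w = (c - G)⁻¹ u + (c - d) (c - G)⁻¹ w`, where `w = (d - G)⁻¹ u`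
    have hpow : ∀ {w : X}, 0 ≤ w → ∀ k : ℕ, 0 ≤ (V.res c ^ k) w := by
      intro w hw k
      induction k with
      | zero => exact hw
      | succ k ih =>
        rw [pow_succ', mul_apply_eq_comp]
        exact hVs.res_nonneg hc ih
    have hpow0 : ∀ k : ℕ, Xi Ψ U.generator B V.generator c ((V.res c ^ k) u) = 0 := by
      intro k
      induction k with
      | zero => exact h0
      | succ k ih =>
        rw [pow_succ', mul_apply_eq_comp]
        exact hres hc (hpow hu k) ih
    set w := V.res d u with hw
    have hw0 : 0 ≤ w := hVs.res_nonneg hd hu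
    obtain ⟨ξ, hξ⟩ := h.exists_xi hV hc
    have hstep : ∀ k : ℕ, ξ w = (c - d) ^ k * ξ ((V.res c ^ k) w) := by
      intro k
      induction k with
      | zero => simp
      | succ k ih =>
        have h1 : w = V.res c u + (c - d) • V.res c w := by
          have := hVs.isContraction.res_sub_res hc hd u
          rw [← hw] at this
          rw [← neg_sub d c, neg_smul, ← this]
          abel
        have h2 : ξ ((V.res c ^ k) w) = (c - d) * ξ ((V.res c ^ (k + 1)) w) := by
          conv_lhs => rw [h1]
          rw [map_add, map_smul, ← mul_apply_eq_comp, ← mul_apply_eq_comp, ← pow_succ, map_add,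
            map_smul, hξ ((V.res c ^ (k + 1)) u), hpow0, zero_add, smul_eq_mul]
        rw [ih, h2]
        ring
    have hnorm : ∀ k : ℕ, ‖(V.res c ^ k) w‖ ≤ c⁻¹ ^ k * ‖w‖ := by
      intro k
      induction k with
      | zero => simp
      | succ k ih =>
        rw [pow_succ', mul_apply_eq_comp, pow_succ', mul_assoc]
        exact (hVs.isContraction.norm_res_le hc _).trans
          (mul_le_mul_of_nonneg_left ih (inv_nonneg.2 hc.le))
    have hlim : Tendsto (fun k : ℕ => ((c - d) * c⁻¹) ^ k * ‖w‖) atTop (𝓝 0) := by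
      have h1 : (c - d) * c⁻¹ < 1 := by
        rw [← div_eq_mul_inv, div_lt_one hc]
        linarith
      have h2 := tendsto_pow_atTop_nhds_zero_of_lt_one
        (mul_nonneg (sub_nonneg.2 hdc.le) (inv_nonneg.2 hc.le)) h1
      simpa using h2.mul_const ‖w‖
    have hle : ξ w ≤ 0 := by
      refine ge_of_tendsto' hlim fun k => ?_
      rw [hstep k, mul_pow, mul_assoc]
      refine mul_le_mul_of_nonneg_left ?_ (pow_nonneg (sub_nonneg.2 hdc.le) k)
      rw [hξ]
      exact (h.Xi_le hV hc (hpow hw0 k)).trans (hnorm k)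
    have h1 : Xi Ψ U.generator B V.generator c w = 0 :=
      le_antisymm (hξ w ▸ hle) (h.Xi_nonneg hV hc hw0)
    rw [← hadd hd hdc hu, h0, h1]
    simp

end IsKatoPerturbation

end Kato

/-! ### The self-adjoint trace class operators as an abstract state space -/

section TraceClassSpace

variable {𝔥 : Type*} [NormedAddCommGroup 𝔥] [InnerProductSpace ℂ 𝔥] [CompleteSpace 𝔥]

theorem isSelfAdjoint_sqrt (T : 𝔥 →L[ℂ] 𝔥) : IsSelfAdjoint (CFC.sqrt T) :=
  (CFC.sqrt_nonneg T).isSelfAdjoint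

theorem sqrt_apply_sqrt {T : 𝔥 →L[ℂ] 𝔥} (hT : 0 ≤ T) (x : 𝔥) :
    CFC.sqrt T (CFC.sqrt T x) = T x :=
  congrArg (fun F : 𝔥 →L[ℂ] 𝔥 => F x) (CFC.sqrt_mul_sqrt_self T hT)

theorem inner_sqrt_left (T : 𝔥 →L[ℂ] 𝔥) (x y : 𝔥) :
    ⟪CFC.sqrt T x, y⟫_ℂ = ⟪x, CFC.sqrt T y⟫_ℂ :=
  (isSelfAdjoint_sqrt T).isSymmetric x y

theorem inner_apply_eq {T : 𝔥 →L[ℂ] 𝔥} (hT : 0 ≤ T) (x : 𝔥) :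
    ⟪x, T x⟫_ℂ = ((‖CFC.sqrt T x‖ ^ 2 : ℝ) : ℂ) := by
  rw [← sqrt_apply_sqrt hT, ← inner_sqrt_left, inner_self_eq_norm_sq_to_K]
  norm_cast

theorem apply_eq_zero_of_inner {T : 𝔥 →L[ℂ] 𝔥} (hT : 0 ≤ T) {x : 𝔥} (hx : ⟪x, T x⟫_ℂ = 0) :
    T x = 0 := by
  rw [inner_apply_eq hT] at hx
  have h : ‖CFC.sqrt T x‖ ^ 2 = 0 := by exact_mod_cast hx
  rw [← sqrt_apply_sqrt hT, norm_eq_zero.1 (pow_eq_zero_iff two_ne_zero |>.1 h), map_zero]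

theorem posTrace_add {S T : 𝔥 →L[ℂ] 𝔥} (hS : 0 ≤ S) (hT : 0 ≤ T) :
    posTrace (S + T) = posTrace S + posTrace T := by
  rw [posTrace, posTrace, posTrace, ← ENNReal.tsum_add]
  refine tsum_congr fun i => ?_
  rw [← ENNReal.ofReal_add (re_inner_nonneg hS _) (re_inner_nonneg hT _), add_apply,
    inner_add_right, Complex.add_re]

theorem ofReal_norm_sqrt_sq_le {T : 𝔥 →L[ℂ] 𝔥} (hT : 0 ≤ T) (x : 𝔥) :
    ENNReal.ofReal (‖CFC.sqrt T x‖ ^ 2) ≤ posTrace T * ENNReal.ofReal (‖x‖ ^ 2) := by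
  rw [← parseval (basis 𝔥), posTrace, ← ENNReal.tsum_mul_right]
  refine ENNReal.tsum_le_tsum fun i => ?_
  rw [← ENNReal.ofReal_mul (re_inner_nonneg hT _), inner_apply_eq hT, Complex.ofReal_re,
    ← inner_sqrt_left, ← mul_pow]
  exact ENNReal.ofReal_le_ofReal (pow_le_pow_left₀ (norm_nonneg _) (norm_inner_le_norm _ _) 2)

theorem norm_le_posTrace {T : 𝔥 →L[ℂ] 𝔥} (hT : 0 ≤ T) (hfin : posTrace T ≠ ∞) :
    ‖T‖ ≤ (posTrace T).toReal := by
  have h1 : ‖CFC.sqrt T‖ ≤ √(posTrace T).toReal := by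
    refine ContinuousLinearMap.opNorm_le_bound _ (Real.sqrt_nonneg _) fun x => ?_
    have h2 := ENNReal.toReal_mono (ENNReal.mul_ne_top hfin ENNReal.ofReal_ne_top)
      (ofReal_norm_sqrt_sq_le hT x)
    rw [ENNReal.toReal_mul, ENNReal.toReal_ofReal (by positivity),
      ENNReal.toReal_ofReal (by positivity)] at h2
    refine abs_le_of_sq_le_sq' ?_ (by positivity) |>.2
    rwa [mul_pow, Real.sq_sqrt ENNReal.toReal_nonneg]
  calc ‖T‖ = ‖CFC.sqrt T * CFC.sqrt T‖ := by rw [CFC.sqrt_mul_sqrt_self T hT]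
    _ ≤ ‖CFC.sqrt T‖ * ‖CFC.sqrt T‖ := norm_mul_le _ _
    _ ≤ √(posTrace T).toReal * √(posTrace T).toReal :=
        mul_le_mul h1 h1 (norm_nonneg _) (Real.sqrt_nonneg _)
    _ = (posTrace T).toReal := Real.mul_self_sqrt ENNReal.toReal_nonneg

theorem tsum_abs_inner_le {ι : Type*} (b : HilbertBasis ι ℂ 𝔥) {S : 𝔥 →L[ℂ] 𝔥}
    (hS : IsSelfAdjoint S) :
    ∑' i, ENNReal.ofReal |(⟪b i, S (b i)⟫_ℂ).re| ≤ posTrace (CFC.abs S) := by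
  rw [posTrace_eq b (CFC.abs_nonneg S)]
  refine ENNReal.tsum_le_tsum fun i => ENNReal.ofReal_le_ofReal ?_
  rw [(inner_parts hS _).1, (inner_parts hS _).2, abs_le]
  have h1 := re_inner_nonneg (CFC.posPart_nonneg S) (b i)
  have h2 := re_inner_nonneg (CFC.negPart_nonneg S) (b i)
  constructor <;> linarith

/-- The trace norm is lower semicontinuous: in a basis adapted to `R` it is
`∑ᵢ |⟨bᵢ, R bᵢ⟩|`, and in any basis it is at least that. -/
theorem posTrace_abs_le_of_tendsto {R : 𝔥 →L[ℂ] 𝔥} {S : ℕ → 𝔥 →L[ℂ] 𝔥} (hR : IsSelfAdjoint R)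
    (hS : ∀ n, IsSelfAdjoint (S n)) (h : Tendsto S atTop (𝓝 R)) {C : ℝ≥0∞}
    (hC : ∀ᶠ n in atTop, posTrace (CFC.abs (S n)) ≤ C) : posTrace (CFC.abs R) ≤ C := by
  obtain ⟨w, b, hb⟩ := exists_adapted_basis R
  have e : posTrace (CFC.abs R) = ∑' i, ENNReal.ofReal |(⟪b i, R (b i)⟫_ℂ).re| := by
    rw [posTrace_eq b (CFC.abs_nonneg R)]
    refine tsum_congr fun i => ?_
    rw [(inner_parts hR _).1, (inner_parts hR _).2]
    have h1 := re_inner_nonneg (CFC.posPart_nonneg R) (b i)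
    have h2 := re_inner_nonneg (CFC.negPart_nonneg R) (b i)
    rcases hb i with h0 | h0
    · rw [h0, inner_zero_right, Complex.zero_re, zero_add, zero_sub, abs_neg, abs_of_nonneg h2]
    · rw [h0, inner_zero_right, Complex.zero_re, add_zero, sub_zero, abs_of_nonneg h1]
  rw [e, ENNReal.tsum_eq_iSup_sum]
  refine iSup_le fun F => ?_
  have hlim : Tendsto (fun n => ∑ i ∈ F, ENNReal.ofReal |(⟪b i, S n (b i)⟫_ℂ).re|) atTop
      (𝓝 (∑ i ∈ F, ENNReal.ofReal |(⟪b i, R (b i)⟫_ℂ).re|)) := by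
    refine tendsto_finsetSum _ fun i _ => ENNReal.tendsto_ofReal ?_
    have h1 : Tendsto (fun n => S n (b i)) atTop (𝓝 (R (b i))) :=
      ((ContinuousLinearMap.apply ℂ 𝔥 (b i)).continuous.tendsto R).comp h
    exact ((Complex.continuous_re.tendsto _).comp (tendsto_const_nhds.inner h1)).abs
  refine le_of_tendsto hlim ?_
  filter_upwards [hC] with n hn
  exact (ENNReal.sum_le_tsum F).trans ((tsum_abs_inner_le b (hS n)).trans hn)

namespace TraceClassSA

theorem norm_def (ϱ : TraceClassSA 𝔥) : ‖ϱ‖ = (posTrace (CFC.abs ϱ.op)).toReal := rfl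

theorem le_iff {ϱ σ : TraceClassSA 𝔥} : ϱ ≤ σ ↔ ϱ.op ≤ σ.op := Iff.rfl

theorem nonneg_iff {ϱ : TraceClassSA 𝔥} : 0 ≤ ϱ ↔ 0 ≤ ϱ.op := Iff.rfl

@[simp] theorem op_zero : (0 : TraceClassSA 𝔥).op = 0 := rfl

@[simp] theorem op_add (ϱ σ : TraceClassSA 𝔥) : (ϱ + σ).op = ϱ.op + σ.op := rfl

@[simp] theorem op_sub (ϱ σ : TraceClassSA 𝔥) : (ϱ - σ).op = ϱ.op - σ.op := rfl

@[simp] theorem op_smul (c : ℝ) (ϱ : TraceClassSA 𝔥) : (c • ϱ).op = c • ϱ.op := rfl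

theorem op_injective : Function.Injective (op : TraceClassSA 𝔥 → 𝔥 →L[ℂ] 𝔥) :=
  Subtype.val_injective

theorem norm_of_nonneg {ϱ : TraceClassSA 𝔥} (h : 0 ≤ ϱ) : ‖ϱ‖ = (posTrace ϱ.op).toReal := by
  rw [norm_def, CFC.abs_of_nonneg _ (nonneg_iff.1 h)]

theorem posTrace_ne_top {ϱ : TraceClassSA 𝔥} (h : 0 ≤ ϱ) : posTrace ϱ.op ≠ ∞ := by
  have : posTrace (CFC.abs ϱ.op) ≠ ∞ := ϱ.2.2
  rwa [CFC.abs_of_nonneg _ (nonneg_iff.1 h)] at this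

/-- A positive operator of finite trace, as an element of the cone. -/
def ofNonneg (T : 𝔥 →L[ℂ] 𝔥) (hT : 0 ≤ T) (hfin : posTrace T ≠ ∞) : TraceClassSA 𝔥 :=
  ⟨T, hT.isSelfAdjoint, by rwa [IsTraceClass, CFC.abs_of_nonneg _ hT]⟩

theorem ofNonneg_nonneg (T : 𝔥 →L[ℂ] 𝔥) (hT : 0 ≤ T) (hfin : posTrace T ≠ ∞) :
    0 ≤ ofNonneg T hT hfin := hT

theorem norm_op_le (ϱ : TraceClassSA 𝔥) : ‖ϱ.op‖ ≤ ‖ϱ‖ := by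
  rw [← CFC.norm_abs (a := ϱ.op)]
  exact norm_le_posTrace (CFC.abs_nonneg _) ϱ.2.2

/-- The inclusion of the trace class into the bounded operators. -/
noncomputable def opL : TraceClassSA 𝔥 →L[ℝ] 𝔥 →L[ℂ] 𝔥 :=
  LinearMap.mkContinuous { toFun := op, map_add' := op_add, map_smul' := op_smul } 1
    fun ϱ => by rw [one_mul]; exact norm_op_le ϱ

theorem opL_apply (ϱ : TraceClassSA 𝔥) : opL ϱ = ϱ.op := rfl

theorem norm_add_of_nonneg {ϱ σ : TraceClassSA 𝔥} (h1 : 0 ≤ ϱ) (h2 : 0 ≤ σ) :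
    ‖ϱ + σ‖ = ‖ϱ‖ + ‖σ‖ := by
  have h3 : 0 ≤ ϱ + σ := nonneg_iff.2 (add_nonneg (nonneg_iff.1 h1) (nonneg_iff.1 h2))
  rw [norm_of_nonneg h1, norm_of_nonneg h2, norm_of_nonneg h3, op_add,
    posTrace_add (nonneg_iff.1 h1) (nonneg_iff.1 h2),
    ENNReal.toReal_add (posTrace_ne_top h1) (posTrace_ne_top h2)]

/-- The Jordan decomposition. -/
theorem exists_posPart_negPart (ϱ : TraceClassSA 𝔥) : ∃ p n : TraceClassSA 𝔥, 0 ≤ p ∧ 0 ≤ n ∧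
    ϱ = p - n ∧ ‖ϱ‖ = ‖p‖ + ‖n‖ ∧ p.op = ϱ.op⁺ ∧ n.op = ϱ.op⁻ := by
  have h1 := CFC.posPart_add_negPart ϱ.op ϱ.2.1
  have hp := CFC.posPart_nonneg ϱ.op
  have hn := CFC.negPart_nonneg ϱ.op
  have h2 : posTrace (CFC.abs ϱ.op) = posTrace (ϱ.op⁺) + posTrace (ϱ.op⁻) := by
    rw [← h1, posTrace_add hp hn]
  have h3 : posTrace (ϱ.op⁺) ≠ ∞ ∧ posTrace (ϱ.op⁻) ≠ ∞ := by
    rw [← ENNReal.add_ne_top, ← h2]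
    exact ϱ.2.2
  refine ⟨ofNonneg _ hp h3.1, ofNonneg _ hn h3.2, ofNonneg_nonneg _ _ _, ofNonneg_nonneg _ _ _,
    op_injective ?_, ?_, rfl, rfl⟩
  · exact (CFC.posPart_sub_negPart ϱ.op ϱ.2.1).symm
  · rw [norm_of_nonneg (ofNonneg_nonneg _ _ _), norm_of_nonneg (ofNonneg_nonneg _ _ _), norm_def, h2]
    exact ENNReal.toReal_add h3.1 h3.2

instance : CompleteSpace (TraceClassSA 𝔥) := by
  refine Metric.complete_of_cauchySeq_tendsto fun u hu => ?_
  obtain ⟨T, hT⟩ := cauchySeq_tendsto_of_complete 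
    ((opL (𝔥 := 𝔥)).uniformContinuous.comp_cauchySeq hu)
  have hT : Tendsto (fun n => (u n).op) atTop (𝓝 T) := hT
  have hTsa : IsSelfAdjoint T := by
    refine tendsto_nhds_unique ?_ hT
    refine ((continuous_star.tendsto T).comp hT).congr fun n => ?_
    exact (u n).2.1
  have key : ∀ ε > 0, ∃ N, ∀ m ≥ N,
      posTrace (CFC.abs (T - (u m).op)) ≤ ENNReal.ofReal ε := by
    intro ε hε
    obtain ⟨N, hN⟩ := Metric.cauchySeq_iff.1 hu ε hε
    refine ⟨N, fun m hm => ?_⟩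
    refine posTrace_abs_le_of_tendsto (S := fun n => (u n).op - (u m).op)
      (hTsa.sub (u m).2.1) (fun n => (u n).2.1.sub (u m).2.1) (hT.sub_const _) ?_
    filter_upwards [eventually_ge_atTop N] with n hn
    have h1 := hN n hn m hm
    rw [dist_eq_norm, norm_def] at h1
    exact (ENNReal.le_ofReal_iff_toReal_le (u n - u m).2.2 hε.le).2 h1.le
  obtain ⟨N, hN⟩ := key 1 one_pos
  have hTtc : IsTraceClass T := by
    have h1 := posTrace_abs_add_le (hTsa.sub (u N).2.1) (u N).2.1
    rw [sub_add_cancel] at h1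
    exact (h1.trans_lt (ENNReal.add_lt_top.2
      ⟨(hN N le_rfl).trans_lt ENNReal.ofReal_lt_top, (u N).2.2.lt_top⟩)).ne
  obtain ⟨σ, hσ⟩ : ∃ σ : TraceClassSA 𝔥, σ.op = T := ⟨⟨T, hTsa, hTtc⟩, rfl⟩
  refine ⟨σ, Metric.tendsto_atTop.2 fun ε hε => ?_⟩
  obtain ⟨M, hM⟩ := key (ε / 2) (by positivity)
  refine ⟨M, fun m hm => ?_⟩
  rw [dist_comm, dist_eq_norm, norm_def, op_sub, hσ]
  refine (ENNReal.toReal_le_of_le_ofReal (by positivity) (hM m hm)).trans_lt (by linarith)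

instance : IsStateSpace (TraceClassSA 𝔥) where
  add_le_add_left _ _ h c := le_iff.2 (add_le_add_left (le_iff.1 h) c.op)
  smul_le_smul_of_nonneg_left _ hc _ _ h := le_iff.2 (smul_le_smul_of_nonneg_left (le_iff.1 h) hc)
  smul_le_smul_of_nonneg_right ϱ hϱ _ _ h :=
    le_iff.2 (smul_le_smul_of_nonneg_right h (nonneg_iff.1 hϱ))
  isClosed_le' := by
    have h1 : Continuous fun p : TraceClassSA 𝔥 × TraceClassSA 𝔥 => p.1.op :=
      opL.continuous.comp continuous_fst
    have h2 : Continuous fun p : TraceClassSA 𝔥 × TraceClassSA 𝔥 => p.2.op :=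
      opL.continuous.comp continuous_snd
    exact (isClosed_le h1 h2 : IsClosed {p : TraceClassSA 𝔥 × TraceClassSA 𝔥 | p.1.op ≤ p.2.op})
  norm_add_of_nonneg _ _ h1 h2 := norm_add_of_nonneg h1 h2
  exists_sub ϱ := by
    obtain ⟨p, n, hp, hn, h1, h2, -⟩ := exists_posPart_negPart ϱ
    exact ⟨p, n, hp, hn, h1, h2⟩

theorem hasSum_norm_sqrt {ϱ : TraceClassSA 𝔥} (h : 0 ≤ ϱ) :
    HasSum (fun i => ‖CFC.sqrt ϱ.op (basis 𝔥 i)‖ ^ 2) ‖ϱ‖ := by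
  have h1 : posTrace ϱ.op
      = ∑' i, ENNReal.ofReal (‖CFC.sqrt ϱ.op (basis 𝔥 i)‖ ^ 2) := by
    rw [posTrace]
    refine tsum_congr fun i => ?_
    rw [inner_apply_eq (nonneg_iff.1 h), Complex.ofReal_re]
  have h2 := ENNReal.hasSum_toReal (h1 ▸ posTrace_ne_top h)
  rw [← ENNReal.tsum_toReal_eq fun _ => ENNReal.ofReal_ne_top, ← h1, ← norm_of_nonneg h] at h2
  convert h2 using 2 with i
  rw [ENNReal.toReal_ofReal (by positivity)]

theorem hasSum_trace {ϱ : TraceClassSA 𝔥} (h : 0 ≤ ϱ) :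
    HasSum (fun i => ⟪basis 𝔥 i, ϱ.op (basis 𝔥 i)⟫_ℂ) (‖ϱ‖ : ℂ) := by
  simp_rw [inner_apply_eq (nonneg_iff.1 h)]
  exact Complex.hasSum_ofReal.2 (hasSum_norm_sqrt h)

theorem summable_trace (ϱ : TraceClassSA 𝔥) :
    Summable fun i => ⟪basis 𝔥 i, ϱ.op (basis 𝔥 i)⟫_ℂ := by
  obtain ⟨p, n, hp, hn, rfl, -⟩ := IsStateSpace.exists_sub ϱ
  refine ((hasSum_trace hp).summable.sub (hasSum_trace hn).summable).congr fun i => ?_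
  rw [op_sub, sub_apply, inner_sub_right]

theorem Psi_of_nonneg {ϱ : TraceClassSA 𝔥} (h : 0 ≤ ϱ) : Psi ϱ = ‖ϱ‖ := by
  rw [Psi, trace, (hasSum_trace h).tsum_eq, Complex.ofReal_re]

/-- The functional `Ψ` as a bounded linear functional. -/
noncomputable def PsiL : TraceClassSA 𝔥 →L[ℝ] ℝ :=
  LinearMap.mkContinuous
    { toFun := Psi
      map_add' := fun ϱ σ => by
        rw [Psi, Psi, Psi, trace, trace, trace, ← Complex.add_re,
          ← (summable_trace ϱ).tsum_add (summable_trace σ)]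
        simp_rw [op_add, add_apply, inner_add_right]
      map_smul' := fun c ϱ => by
        have e : ∀ i, ⟪basis 𝔥 i, (c • ϱ).op (basis 𝔥 i)⟫_ℂ
            = (c : ℂ) * ⟪basis 𝔥 i, ϱ.op (basis 𝔥 i)⟫_ℂ := fun i => by
          rw [op_smul, smul_apply, ← Complex.coe_smul, inner_smul_right]
        rw [Psi, Psi, trace, trace]
        simp_rw [e]
        rw [tsum_mul_left, Complex.re_ofReal_mul, RingHom.id_apply, smul_eq_mul] }
    1 (norm_le_of_cone _ fun ϱ h => by
      change ‖Psi ϱ‖ ≤ _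
      rw [Psi_of_nonneg h, norm_norm, one_mul])

theorem coe_PsiL : ⇑(PsiL (𝔥 := 𝔥)) = Psi := rfl

end TraceClassSA

end TraceClassSpace

/-! ### Hilbert–Schmidt operators and commutation under the trace -/

section Representation

variable {𝔥 : Type*} [NormedAddCommGroup 𝔥] [InnerProductSpace ℂ 𝔥] [CompleteSpace 𝔥]

theorem hasSum_norm_inner_sq (x : 𝔥) :
    HasSum (fun i => ‖⟪basis 𝔥 i, x⟫_ℂ‖ ^ 2) (‖x‖ ^ 2) := by
  have h := Complex.hasSum_re ((basis 𝔥).hasSum_inner_mul_inner x x)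
  convert h using 1
  · funext i
    rw [← inner_conj_symm x (basis 𝔥 i), RCLike.conj_mul]
    norm_cast
  · rw [inner_self_eq_norm_sq_to_K]
    norm_cast

/-- The matrix entries of a Hilbert–Schmidt operator are square summable. -/
theorem summable_matrix {A : 𝔥 →L[ℂ] 𝔥} (hA : Summable fun i => ‖A (basis 𝔥 i)‖ ^ 2) :
    Summable fun p : basisSet 𝔥 × basisSet 𝔥 => ‖⟪basis 𝔥 p.2, A (basis 𝔥 p.1)⟫_ℂ‖ ^ 2 := by
  refine (summable_prod_of_nonneg fun _ => by positivity).2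
    ⟨fun i => (hasSum_norm_inner_sq (A (basis 𝔥 i))).summable, hA.congr fun i => ?_⟩
  exact (hasSum_norm_inner_sq (A (basis 𝔥 i))).tsum_eq.symm

theorem summable_adjoint {A : 𝔥 →L[ℂ] 𝔥} (hA : Summable fun i => ‖A (basis 𝔥 i)‖ ^ 2) :
    Summable fun i => ‖A.adjoint (basis 𝔥 i)‖ ^ 2 := by
  have h := (summable_prod_of_nonneg fun _ => sq_nonneg _).1
    ((Equiv.prodComm (basisSet 𝔥) (basisSet 𝔥)).summable_iff.2 (summable_matrix hA))
  refine h.2.congr fun i => ?_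
  rw [← (hasSum_norm_inner_sq (A.adjoint (basis 𝔥 i))).tsum_eq]
  refine tsum_congr fun j => ?_
  change ‖⟪basis 𝔥 i, A (basis 𝔥 j)⟫_ℂ‖ ^ 2 = ‖⟪basis 𝔥 j, A.adjoint (basis 𝔥 i)⟫_ℂ‖ ^ 2
  rw [ContinuousLinearMap.adjoint_inner_right, norm_inner_symm]

/-- `Trace (A* B) = Trace (B A*)` for Hilbert–Schmidt operators `A` and `B`. -/
theorem exists_hasSum_inner {A B : 𝔥 →L[ℂ] 𝔥} (hA : Summable fun i => ‖A (basis 𝔥 i)‖ ^ 2)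
    (hB : Summable fun i => ‖B (basis 𝔥 i)‖ ^ 2) :
    ∃ s : ℂ, HasSum (fun i => ⟪A (basis 𝔥 i), B (basis 𝔥 i)⟫_ℂ) s ∧
      HasSum (fun i => ⟪B.adjoint (basis 𝔥 i), A.adjoint (basis 𝔥 i)⟫_ℂ) s := by
  obtain ⟨f, hf⟩ : ∃ f : basisSet 𝔥 × basisSet 𝔥 → ℂ, ∀ i j, f (i, j)
      = ⟪A (basis 𝔥 i), basis 𝔥 j⟫_ℂ * ⟪basis 𝔥 j, B (basis 𝔥 i)⟫_ℂ :=
    ⟨fun p => ⟪A (basis 𝔥 p.1), basis 𝔥 p.2⟫_ℂ * ⟪basis 𝔥 p.2, B (basis 𝔥 p.1)⟫_ℂ,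
      fun _ _ => rfl⟩
  have hs : Summable f := by
    refine Summable.of_norm_bounded ((summable_matrix hA).add (summable_matrix hB)) ?_
    rintro ⟨i, j⟩
    rw [hf, norm_mul, norm_inner_symm]
    nlinarith [sq_nonneg (‖⟪basis 𝔥 j, A (basis 𝔥 i)⟫_ℂ‖ - ‖⟪basis 𝔥 j, B (basis 𝔥 i)⟫_ℂ‖),
      sq_nonneg ‖⟪basis 𝔥 j, A (basis 𝔥 i)⟫_ℂ‖, sq_nonneg ‖⟪basis 𝔥 j, B (basis 𝔥 i)⟫_ℂ‖]
  refine ⟨∑' p, f p, ?_, ?_⟩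
  · refine hs.hasSum.prod_fiberwise fun i => ?_
    simp_rw [hf]
    exact (basis 𝔥).hasSum_inner_mul_inner _ _
  · have h2 := (Equiv.prodComm (basisSet 𝔥) (basisSet 𝔥)).hasSum_iff.2 hs.hasSum
    refine h2.prod_fiberwise fun j => ?_
    have e : ∀ i, (f ∘ Equiv.prodComm (basisSet 𝔥) (basisSet 𝔥)) (j, i)
        = ⟪B.adjoint (basis 𝔥 j), basis 𝔥 i⟫_ℂ * ⟪basis 𝔥 i, A.adjoint (basis 𝔥 j)⟫_ℂ := by
      intro i
      change f (i, j) = _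
      rw [hf, ContinuousLinearMap.adjoint_inner_left, ContinuousLinearMap.adjoint_inner_right,
        mul_comm]
    simp_rw [e]
    exact (basis 𝔥).hasSum_inner_mul_inner _ _

namespace TraceClassSA

/-- `Trace (β ϱ) = ∑ᵢ ⟨√ϱ eᵢ, β √ϱ eᵢ⟩`. -/
theorem hasSum_inner_sqrt {ϱ : TraceClassSA 𝔥} (h : 0 ≤ ϱ) (β : 𝔥 →L[ℂ] 𝔥) :
    HasSum (fun i => ⟪CFC.sqrt ϱ.op (basis 𝔥 i), β (CFC.sqrt ϱ.op (basis 𝔥 i))⟫_ℂ)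
      (trace (β ∘L ϱ.op)) := by
  set S := CFC.sqrt ϱ.op with hS
  have hSadj : S.adjoint = S := (isSelfAdjoint_sqrt ϱ.op).adjoint_eq
  have hS2 : Summable fun i => ‖S (basis 𝔥 i)‖ ^ 2 := (hasSum_norm_sqrt h).summable
  have hβS : Summable fun i => ‖(β ∘L S) (basis 𝔥 i)‖ ^ 2 := by
    refine Summable.of_nonneg_of_le (fun _ => by positivity) (fun i => ?_)
      (hS2.mul_left (‖β‖ ^ 2))
    rw [← mul_pow]
    exact pow_le_pow_left₀ (norm_nonneg _) (β.le_opNorm _) 2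
  obtain ⟨s, h1, h2⟩ := exists_hasSum_inner (summable_adjoint hβS) hS2
  rw [ContinuousLinearMap.adjoint_adjoint, hSadj] at h2
  have e : ∀ i, ⟪(β ∘L S).adjoint (basis 𝔥 i), S (basis 𝔥 i)⟫_ℂ
      = ⟪basis 𝔥 i, (β ∘L ϱ.op) (basis 𝔥 i)⟫_ℂ := by
    intro i
    rw [ContinuousLinearMap.adjoint_inner_left, ContinuousLinearMap.comp_apply,
      ContinuousLinearMap.comp_apply, sqrt_apply_sqrt (nonneg_iff.1 h)]
  simp_rw [e] at h1
  rw [trace, h1.tsum_eq]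
  exact h2

/-! ### Rank one operators and the representation of positive functionals -/

theorem inner_rankOne (x y z w : 𝔥) :
    ⟪w, InnerProductSpace.rankOne ℂ x y z⟫_ℂ = ⟪y, z⟫_ℂ * ⟪w, x⟫_ℂ := by
  rw [InnerProductSpace.rankOne_apply, inner_smul_right]

theorem rankOne_self_nonneg (x : 𝔥) : 0 ≤ InnerProductSpace.rankOne ℂ x x :=
  (ContinuousLinearMap.nonneg_iff_isPositive _).2 (InnerProductSpace.isPositive_rankOne_self x)

theorem posTrace_rankOne_self (x : 𝔥) :
    posTrace (InnerProductSpace.rankOne ℂ x x) = ENNReal.ofReal (‖x‖ ^ 2) := by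
  rw [← parseval (basis 𝔥), posTrace]
  refine tsum_congr fun i => ?_
  rw [inner_rankOne, ← inner_conj_symm x (basis 𝔥 i), RCLike.conj_mul]
  norm_cast

/-- The positive rank one operator `|x⟩⟨x|`. -/
noncomputable def rankOneSelf (x : 𝔥) : TraceClassSA 𝔥 :=
  ofNonneg (InnerProductSpace.rankOne ℂ x x) (rankOne_self_nonneg x)
    (by rw [posTrace_rankOne_self]; exact ENNReal.ofReal_ne_top)

theorem rankOneSelf_nonneg (x : 𝔥) : 0 ≤ rankOneSelf x := ofNonneg_nonneg _ _ _

theorem op_rankOneSelf (x : 𝔥) : (rankOneSelf x).op = InnerProductSpace.rankOne ℂ x x := rfl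

theorem norm_rankOneSelf (x : 𝔥) : ‖rankOneSelf x‖ = ‖x‖ ^ 2 := by
  rw [norm_of_nonneg (rankOneSelf_nonneg x), op_rankOneSelf, posTrace_rankOne_self,
    ENNReal.toReal_ofReal (by positivity)]

/-- `ϱ = ∑ᵢ |√ϱ eᵢ⟩⟨√ϱ eᵢ|`, convergent in the trace norm. -/
theorem hasSum_rankOneSelf {ϱ : TraceClassSA 𝔥} (h : 0 ≤ ϱ) :
    HasSum (fun i => rankOneSelf (CFC.sqrt ϱ.op (basis 𝔥 i))) ϱ := by
  have hpos : ∀ F : Finset (basisSet 𝔥),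
      0 ≤ ∑ i ∈ F, rankOneSelf (CFC.sqrt ϱ.op (basis 𝔥 i)) :=
    fun F => Finset.sum_nonneg fun _ _ => rankOneSelf_nonneg _
  have hnorm : ∀ F : Finset (basisSet 𝔥),
      ‖∑ i ∈ F, rankOneSelf (CFC.sqrt ϱ.op (basis 𝔥 i))‖
        = ∑ i ∈ F, ‖CFC.sqrt ϱ.op (basis 𝔥 i)‖ ^ 2 := by
    intro F
    rw [← Psi_of_nonneg (hpos F), ← coe_PsiL, map_sum]
    refine Finset.sum_congr rfl fun i _ => ?_
    rw [coe_PsiL, Psi_of_nonneg (rankOneSelf_nonneg _), norm_rankOneSelf]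
  have hle : ∀ F : Finset (basisSet 𝔥),
      ∑ i ∈ F, rankOneSelf (CFC.sqrt ϱ.op (basis 𝔥 i)) ≤ ϱ := by
    intro F
    rw [← sub_nonneg, nonneg_iff, ContinuousLinearMap.nonneg_iff_isPositive,
      ContinuousLinearMap.isPositive_iff]
    set D := ϱ - ∑ i ∈ F, rankOneSelf (CFC.sqrt ϱ.op (basis 𝔥 i)) with hD
    refine ⟨IsSelfAdjoint.isSymmetric D.2.1, fun x => ?_⟩
    have e : ⟪x, D.op x⟫_ℂ = ((‖CFC.sqrt ϱ.op x‖ ^ 2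
        - ∑ i ∈ F, ‖⟪basis 𝔥 i, CFC.sqrt ϱ.op x⟫_ℂ‖ ^ 2 : ℝ) : ℂ) := by
      rw [hD, ← opL_apply, map_sub, map_sum, sub_apply, sum_apply, inner_sub_right, inner_sum,
        opL_apply, inner_apply_eq (nonneg_iff.1 h), Complex.ofReal_sub, Complex.ofReal_sum]
      congr 1
      refine Finset.sum_congr rfl fun i _ => ?_
      rw [opL_apply, op_rankOneSelf, inner_rankOne, inner_sqrt_left, ← inner_conj_symm x,
        inner_sqrt_left, RCLike.mul_conj]
      norm_cast
    rw [← inner_conj_symm, e, Complex.conj_ofReal]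
    rw [Complex.zero_le_real, sub_nonneg]
    exact sum_le_hasSum F (fun _ _ => by positivity) (hasSum_norm_inner_sq (CFC.sqrt ϱ.op x))
  have h1 := (hasSum_norm_sqrt h)
  rw [HasSum, tendsto_iff_norm_sub_tendsto_zero]
  have h2 := h1.const_sub ‖ϱ‖
  rw [sub_self] at h2
  refine h2.congr fun F => ?_
  rw [norm_sub_rev, norm_sub_of_le (hpos F) (hle F), hnorm]

/-- The operator `|x⟩⟨y| + |y⟩⟨x|`, written by polarization. -/
noncomputable def rankOneSym (x y : 𝔥) : TraceClassSA 𝔥 :=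
  (2⁻¹ : ℝ) • (rankOneSelf (x + y) - rankOneSelf (x - y))

theorem op_rankOneSym (x y : 𝔥) : (rankOneSym x y).op
    = InnerProductSpace.rankOne ℂ x y + InnerProductSpace.rankOne ℂ y x := by
  rw [rankOneSym, op_smul, op_sub, op_rankOneSelf, op_rankOneSelf]
  simp only [map_add, map_sub, add_apply, sub_apply]
  module

theorem norm_rankOneSym_le_add (x y : 𝔥) : ‖rankOneSym x y‖ ≤ ‖x‖ ^ 2 + ‖y‖ ^ 2 := by
  have h1 := parallelogram_law_with_norm ℂ x y
  have h2 := norm_sub_le (rankOneSelf (x + y)) (rankOneSelf (x - y))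
  rw [norm_rankOneSelf, norm_rankOneSelf] at h2
  rw [rankOneSym, norm_smul, Real.norm_of_nonneg (by norm_num)]
  nlinarith

theorem norm_rankOneSym_le (x y : 𝔥) : ‖rankOneSym x y‖ ≤ 2 * ‖x‖ * ‖y‖ := by
  rcases eq_or_ne x 0 with rfl | hx
  · have : rankOneSym 0 y = 0 := op_injective (by simp [op_rankOneSym])
    simp [this]
  rcases eq_or_ne y 0 with rfl | hy
  · have : rankOneSym x 0 = 0 := op_injective (by simp [op_rankOneSym])
    simp [this]
  have hx' := norm_pos_iff.2 hx
  have hy' := norm_pos_iff.2 hy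
  -- rescaling `x` by `t` and `y` by `t⁻¹` with `t² = ‖y‖ / ‖x‖` balances the two norms
  set t : ℝ := √(‖y‖ / ‖x‖) with ht
  have ht0 : 0 < t := Real.sqrt_pos.2 (by positivity)
  have ht2 : t ^ 2 = ‖y‖ / ‖x‖ := Real.sq_sqrt (by positivity)
  have e : rankOneSym x y = rankOneSym ((t : ℂ) • x) (((t⁻¹ : ℝ) : ℂ) • y) := by
    refine op_injective ?_
    have ht0' : (t : ℂ) ≠ 0 := by exact_mod_cast ht0.ne'
    ext z
    simp only [op_rankOneSym, add_apply, InnerProductSpace.rankOne_apply, inner_smul_left,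
      Complex.conj_ofReal, smul_smul, Complex.ofReal_inv, map_inv₀]
    congr 2 <;> field_simp
  rw [e]
  refine (norm_rankOneSym_le_add _ _).trans_eq ?_
  rw [norm_smul, norm_smul, Complex.norm_real, Complex.norm_real, Real.norm_of_nonneg ht0.le,
    Real.norm_of_nonneg (by positivity), mul_pow, mul_pow, inv_pow, ht2]
  field_simp
  ring

/-- A bounded functional on the self-adjoint trace class operators that is nonnegative on the
cone is given on rank one operators by a positive operator. -/
theorem exists_isPositive (ξ : TraceClassSA 𝔥 →L[ℝ] ℝ) (hξ : ∀ ϱ, 0 ≤ ϱ → 0 ≤ ξ ϱ) :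
    ∃ β : 𝔥 →L[ℂ] 𝔥, β.IsPositive ∧ ∀ x, ⟪x, β x⟫_ℂ = ξ (rankOneSelf x) := by
  obtain ⟨b, hb⟩ : ∃ b : 𝔥 → 𝔥 → ℝ, ∀ x y, b x y = ξ (rankOneSym x y) := ⟨_, fun _ _ => rfl⟩
  have hadd1 : ∀ x x' y, b (x + x') y = b x y + b x' y := by
    intro x x' y
    rw [hb, hb, hb, ← map_add]
    congr 1
    refine op_injective ?_
    simp only [op_rankOneSym, op_add, map_add, add_apply]
    abel
  have hsymm : ∀ x y, b x y = b y x := by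
    intro x y
    rw [hb, hb]
    congr 1
    refine op_injective ?_
    rw [op_rankOneSym, op_rankOneSym, add_comm]
  have hadd2 : ∀ x y y', b x (y + y') = b x y + b x y' := fun x y y' => by
    rw [hsymm, hadd1, hsymm y, hsymm y']
  have hreal : ∀ (r : ℝ) x y, b ((r : ℂ) • x) y = r * b x y := by
    intro r x y
    rw [hb, hb, ← smul_eq_mul, ← map_smul]
    congr 1
    refine op_injective ?_
    ext z
    simp only [op_rankOneSym, op_smul, add_apply, smul_apply, InnerProductSpace.rankOne_apply,
      inner_smul_left, Complex.conj_ofReal, ← Complex.coe_smul, smul_smul]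
    module
  have hI : ∀ x y, b (Complex.I • x) y = -b x (Complex.I • y) := by
    intro x y
    rw [hb, hb, ← map_neg]
    congr 1
    refine op_injective ?_
    rw [← neg_one_smul ℝ]
    ext z
    simp only [op_rankOneSym, op_smul, add_apply, smul_apply, InnerProductSpace.rankOne_apply,
      inner_smul_left, Complex.conj_I, smul_smul]
    module
  have hreal2 : ∀ (r : ℝ) x y, b x ((r : ℂ) • y) = r * b x y := fun r x y => by
    rw [hsymm, hreal, hsymm]
  -- `b x y` is to be `2 Re ⟨x, β y⟩`, so `b (i x) y` is twice the imaginary part, and `g` the form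
  obtain ⟨g, hg⟩ : ∃ g : 𝔥 → 𝔥 → ℂ, ∀ x y, g x y
      = ((b x y / 2 : ℝ) : ℂ) + Complex.I * ((b (Complex.I • x) y / 2 : ℝ) : ℂ) :=
    ⟨_, fun _ _ => rfl⟩
  have hgadd1 : ∀ x x' y, g (x + x') y = g x y + g x' y := by
    intro x x' y
    simp only [hg, smul_add, hadd1]
    push_cast
    ring
  have hgadd2 : ∀ x y y', g x (y + y') = g x y + g x y' := by
    intro x y y'
    simp only [hg, hadd2]
    push_cast
    ring
  have hII : ∀ x : 𝔥, Complex.I • Complex.I • x = ((-1 : ℝ) : ℂ) • x := by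
    intro x
    rw [smul_smul, Complex.I_mul_I]
    norm_num
  have hsplit : ∀ (a : ℂ) (x : 𝔥), a • x = (a.re : ℂ) • x + (a.im : ℂ) • Complex.I • x := by
    intro a x
    conv_lhs => rw [← Complex.re_add_im a, add_smul, mul_smul]
  have hgsmul1 : ∀ (a : ℂ) x y, g (a • x) y = (starRingEnd ℂ) a * g x y := by
    intro a x y
    have h1 : b (a • x) y = a.re * b x y + a.im * b (Complex.I • x) y := by
      rw [hsplit, hadd1, hreal, hreal]
    have h2 : b (Complex.I • a • x) y = a.re * b (Complex.I • x) y - a.im * b x y := by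
      rw [smul_comm, hsplit, hadd1, hreal, hreal, hII, hreal]
      ring
    rw [hg, hg, h1, h2]
    apply Complex.ext <;> simp <;> ring
  have hgsmul2 : ∀ (a : ℂ) x y, g x (a • y) = a * g x y := by
    intro a x y
    have h1 : b x (a • y) = a.re * b x y - a.im * b (Complex.I • x) y := by
      rw [hsplit, hadd2, hreal2, hreal2, hI]
      ring
    have h2 : b (Complex.I • x) (a • y) = a.re * b (Complex.I • x) y + a.im * b x y := by
      rw [hsplit a y, hadd2, hreal2, hreal2, hI x (Complex.I • y), hII, hreal2]
      ring
    rw [hg, hg, h1, h2]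
    apply Complex.ext <;> simp <;> ring
  have hbound : ∀ x y, |b x y| ≤ 2 * ‖ξ‖ * ‖x‖ * ‖y‖ := by
    intro x y
    rw [hb]
    calc |ξ (rankOneSym x y)| ≤ ‖ξ‖ * ‖rankOneSym x y‖ := ξ.le_opNorm _
      _ ≤ ‖ξ‖ * (2 * ‖x‖ * ‖y‖) :=
          mul_le_mul_of_nonneg_left (norm_rankOneSym_le x y) (norm_nonneg _)
      _ = 2 * ‖ξ‖ * ‖x‖ * ‖y‖ := by ring
  have hgbound : ∀ x y, ‖g x y‖ ≤ (2 * ‖ξ‖) * ‖x‖ * ‖y‖ := by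
    intro x y
    rw [hg]
    refine (norm_add_le _ _).trans ?_
    rw [norm_mul, Complex.norm_I, one_mul, Complex.norm_real, Complex.norm_real, Real.norm_eq_abs,
      Real.norm_eq_abs, abs_div, abs_div, abs_two]
    have h1 := hbound x y
    have h2 := hbound (Complex.I • x) y
    rw [norm_smul, Complex.norm_I, one_mul] at h2
    linarith
  let G : 𝔥 →L⋆[ℂ] 𝔥 →L[ℂ] ℂ := LinearMap.mkContinuous₂
    (LinearMap.mk₂'ₛₗ (starRingEnd ℂ) (RingHom.id ℂ) g hgadd1 hgsmul1 hgadd2 hgsmul2)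
    (2 * ‖ξ‖) hgbound
  have hdiag : ∀ x, g x x = ξ (rankOneSelf x) := by
    intro x
    have h1 : b (Complex.I • x) x = 0 := by
      have h2 := hI x x
      rw [hsymm x (Complex.I • x)] at h2
      linarith
    have h2 : b x x = 2 * ξ (rankOneSelf x) := by
      rw [hb, ← smul_eq_mul, ← map_smul]
      congr 1
      refine op_injective ?_
      rw [op_rankOneSym, op_smul, op_rankOneSelf, two_smul]
    rw [hg, h1, h2]
    simp
  have hβ : ∀ x, ⟪InnerProductSpace.continuousLinearMapOfBilin G x, x⟫_ℂ
      = ξ (rankOneSelf x) := fun x =>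
    (InnerProductSpace.continuousLinearMapOfBilin_apply G x x).trans (hdiag x)
  refine ⟨InnerProductSpace.continuousLinearMapOfBilin G, ?_, fun x => ?_⟩
  · rw [ContinuousLinearMap.isPositive_iff_complex]
    intro x
    rw [hβ]
    exact ⟨by simp, by simpa using hξ _ (rankOneSelf_nonneg x)⟩
  · rw [← inner_conj_symm, hβ, Complex.conj_ofReal]

theorem exists_represents (ξ : TraceClassSA 𝔥 →L[ℝ] ℝ) (hξ : ∀ ϱ, 0 ≤ ϱ → 0 ≤ ξ ϱ) :
    ∃ β : 𝔥 →L[ℂ] 𝔥, Represents β ξ := by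
  obtain ⟨β, hβ, h⟩ := exists_isPositive ξ hξ
  refine ⟨β, hβ, fun ϱ hϱ => ?_⟩
  have h1 := Complex.hasSum_ofReal.2 ((hasSum_rankOneSelf hϱ).mapL ξ)
  have h2 := hasSum_inner_sqrt hϱ β
  simp_rw [h] at h2
  exact h1.unique h2

end TraceClassSA

/-! ### Null spaces of representing operators -/

open TraceClassSA

variable {β : 𝔥 →L[ℂ] 𝔥} {ξ : TraceClassSA 𝔥 → ℝ}

theorem Represents.nonneg (h : Represents β ξ) : 0 ≤ β :=
  (ContinuousLinearMap.nonneg_iff_isPositive β).2 h.1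

theorem Represents.inner_eq (h : Represents β ξ) (x : 𝔥) :
    ⟪x, β x⟫_ℂ = ξ (rankOneSelf x) := by
  rw [h.2 _ (rankOneSelf_nonneg x), trace]
  have h1 := (basis 𝔥).hasSum_inner_mul_inner x (β x)
  rw [← h1.tsum_eq]
  refine tsum_congr fun i => ?_
  rw [op_rankOneSelf, ContinuousLinearMap.comp_apply, InnerProductSpace.rankOne_apply, map_smul,
    inner_smul_right]

theorem Represents.apply_eq_zero_iff (h : Represents β ξ) (x : 𝔥) :
    β x = 0 ↔ ξ (rankOneSelf x) = 0 := by
  rw [← Complex.ofReal_eq_zero, ← h.inner_eq]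
  exact ⟨fun h0 => by rw [h0, inner_zero_right], apply_eq_zero_of_inner h.nonneg⟩

theorem Represents.eq_zero_iff (h : Represents β ξ) {ϱ : TraceClassSA 𝔥} (hϱ : 0 ≤ ϱ) :
    ξ ϱ = 0 ↔ β ∘L ϱ.op = 0 := by
  rw [← Complex.ofReal_eq_zero, h.2 ϱ hϱ]
  refine ⟨fun h0 => ?_, fun h0 => by rw [h0, trace]; simp⟩
  have h1 := hasSum_inner_sqrt hϱ β
  rw [h0] at h1
  simp_rw [inner_apply_eq h.nonneg] at h1
  have h2 : HasSum (fun i => ‖CFC.sqrt β (CFC.sqrt ϱ.op (basis 𝔥 i))‖ ^ 2) 0 := by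
    rw [← Complex.ofReal_zero] at h1
    exact Complex.hasSum_ofReal.1 h1
  have h3 := (hasSum_zero_iff_of_nonneg fun _ => by positivity).1 h2
  have h4 : ∀ i, (β ∘L CFC.sqrt ϱ.op) (basis 𝔥 i) = 0 := by
    intro i
    have h5 : ‖CFC.sqrt β (CFC.sqrt ϱ.op (basis 𝔥 i))‖ ^ 2 = 0 := congrFun h3 i
    rw [ContinuousLinearMap.comp_apply, ← sqrt_apply_sqrt h.nonneg,
      norm_eq_zero.1 (pow_eq_zero_iff two_ne_zero |>.1 h5), map_zero]
  have h6 : β ∘L CFC.sqrt ϱ.op = 0 := by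
    ext x
    have hx := ((basis 𝔥).hasSum_repr x).mapL (β ∘L CFC.sqrt ϱ.op)
    have hz : HasSum (fun i => (β ∘L CFC.sqrt ϱ.op) ((basis 𝔥).repr x i • basis 𝔥 i)) 0 := by
      convert hasSum_zero with i
      rw [map_smul, h4 i, smul_zero]
    exact hx.unique hz
  ext x
  rw [ContinuousLinearMap.comp_apply, ← sqrt_apply_sqrt (nonneg_iff.1 hϱ)]
  exact congrArg (fun F : 𝔥 →L[ℂ] 𝔥 => F (CFC.sqrt ϱ.op x)) h6

end Representation

/-! ### Supports of trace class operators -/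

section Support

variable {𝔥 : Type*} [NormedAddCommGroup 𝔥] [InnerProductSpace ℂ 𝔥] [CompleteSpace 𝔥]

/-- An operator that annihilates the range of `T` annihilates the range of `T⁺`: as
`T T⁺ = (T⁺)²`, one has `(Q T⁺) (Q T⁺)* = Q T T⁺ Q* = 0`. -/
theorem mul_posPart_eq_zero {Q T : 𝔥 →L[ℂ] 𝔥} (hT : IsSelfAdjoint T) (h : Q * T = 0) :
    Q * T⁺ = 0 := by
  have h1 : T * T⁺ = T⁺ * T⁺ := by
    have e : T * T⁺ = (T⁺ - T⁻) * T⁺ :=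
      congrArg (· * T⁺) (CFC.posPart_sub_negPart T hT).symm
    rw [e, sub_mul, CFC.negPart_mul_posPart, sub_zero]
  have h2 : star (T⁺) = T⁺ := (CFC.posPart_nonneg T).isSelfAdjoint
  rw [← CStarRing.mul_star_self_eq_zero_iff, star_mul, h2, mul_assoc, ← mul_assoc (T⁺), ← h1,
    mul_assoc T, ← mul_assoc Q, h, zero_mul]

theorem mul_negPart_eq_zero {Q T : 𝔥 →L[ℂ] 𝔥} (hT : IsSelfAdjoint T) (h : Q * T = 0) :
    Q * T⁻ = 0 := by
  rw [← CFC.posPart_neg]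
  exact mul_posPart_eq_zero hT.neg (by rw [mul_neg, h, neg_zero])

theorem comp_eq_zero_iff (β T : 𝔥 →L[ℂ] 𝔥) :
    β ∘L T = 0 ↔ T = β.ker.starProjection ∘L T := by
  constructor
  · intro h
    ext x
    have hx : T x ∈ β.ker := congrArg (fun F : 𝔥 →L[ℂ] 𝔥 => F x) h
    exact (Submodule.starProjection_eq_self_iff.2 hx).symm
  · intro h
    ext x
    have hx : β.ker.starProjection (T x) = T x := (congrArg (fun F : 𝔥 →L[ℂ] 𝔥 => F x) h).symm
    exact Submodule.starProjection_eq_self_iff.1 hx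

theorem eq_comp_of_eq_comp {P T : 𝔥 →L[ℂ] 𝔥} (hP : IsSelfAdjoint P) (hT : IsSelfAdjoint T)
    (h : T = P ∘L T) : T = T ∘L P := by
  have h1 := congrArg star h
  change star T = star (P * T) at h1
  rwa [star_mul, hT.star_eq, hP.star_eq] at h1

end Support

end Honesty

open Honesty in
theorem mainTheorem12 {𝔥 : Type*} [NormedAddCommGroup 𝔥] [InnerProductSpace ℂ 𝔥] [CompleteSpace 𝔥]
    [TopologicalSpace.SeparableSpace 𝔥]
    (U : C0Semigroup (TraceClassSA 𝔥)) (hU : IsSubstochastic U)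
    (B : U.generator.domain →ₗ[ℝ] TraceClassSA 𝔥)
    (hBpos : ∀ v : U.generator.domain, 0 ≤ (v : TraceClassSA 𝔥) → 0 ≤ B v)
    (hAB : ∀ v : U.generator.domain, 0 ≤ (v : TraceClassSA 𝔥) →
      TraceClassSA.Psi (U.generator v + B v) ≤ 0)
    (V : C0Semigroup (TraceClassSA 𝔥)) (hV : IsMinimalSemigroup U.generator B V)
    (Ξ : ℝ → TraceClassSA 𝔥 → ℝ)
    (hΞ : Ξ = Xi TraceClassSA.Psi U.generator B V.generator)
    (H : Set (TraceClassSA 𝔥))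
    (hH : H = honestSet TraceClassSA.Psi U.generator B V.generator) :
    (∃ β : ℝ → 𝔥 →L[ℂ] 𝔥, ∀ lam : ℝ, 0 < lam → Represents (β lam) (Ξ lam)) ∧
    ∀ β : ℝ → 𝔥 →L[ℂ] 𝔥, (∀ lam : ℝ, 0 < lam → Represents (β lam) (Ξ lam)) →
      (∀ lam mu : ℝ, 0 < lam → 0 < mu → (β lam).ker = (β mu).ker) ∧
      ∀ lam : ℝ, 0 < lam → ∀ P Q : 𝔥 →L[ℂ] 𝔥,
        P = (β lam).ker.starProjection → Q = ContinuousLinearMap.id ℂ 𝔥 - P →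
        H = {ϱ | 0 ≤ ϱ ∧ ϱ.op = P ∘L ϱ.op ∧ ϱ.op = ϱ.op ∘L P} ∧
        H = {ϱ | 0 ≤ ϱ ∧ Q ∘L ϱ.op = 0 ∧ ϱ.op ∘L Q = 0} ∧
        H - H = {ϱ | ϱ.op = P ∘L ϱ.op ∧ ϱ.op = ϱ.op ∘L P} := by
  have h : IsKatoPerturbation (TraceClassSA.PsiL (𝔥 := 𝔥)) U B :=
    ⟨fun _ hu => TraceClassSA.Psi_of_nonneg hu, hU, hBpos, hAB⟩
  rw [← TraceClassSA.coe_PsiL] at hΞ hH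
  subst hΞ
  refine ⟨?_, fun β hβ => ⟨fun lam mu hlam hmu => ?_, fun lam hlam P Q hP hQ => ?_⟩⟩
  · -- totalized in `lam`, so that a family can be chosen
    have hex : ∀ lam : ℝ, ∃ β : 𝔥 →L[ℂ] 𝔥, 0 < lam → Represents β
        (Xi TraceClassSA.PsiL U.generator B V.generator lam) := by
      intro lam
      by_cases hlam : 0 < lam
      · obtain ⟨ξ, hξ⟩ := h.exists_xi hV hlam
        obtain ⟨β, hβ⟩ := TraceClassSA.exists_represents ξ fun ϱ hϱ => by
          rw [hξ]
          exact h.Xi_nonneg hV hlam hϱ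
        rw [funext hξ] at hβ
        exact ⟨β, fun _ => hβ⟩
      · exact ⟨0, fun h0 => absurd h0 hlam⟩
    exact ⟨fun lam => (hex lam).choose, fun lam => (hex lam).choose_spec⟩
  · ext x
    have hx := TraceClassSA.rankOneSelf_nonneg x
    exact ((hβ lam hlam).apply_eq_zero_iff x).trans (Iff.trans
      ⟨h.Xi_eq_zero hV hlam hmu hx, h.Xi_eq_zero hV hmu hlam hx⟩
      ((hβ mu hmu).apply_eq_zero_iff x).symm)
  · have hPsa : IsSelfAdjoint P := hP ▸ isSelfAdjoint_starProjection _
    -- by the independence of the parameter, the single value `lam` decides membership in `H`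
    have hmem : ∀ ϱ, ϱ ∈ H ↔ 0 ≤ ϱ ∧ ϱ.op = P ∘L ϱ.op := by
      intro ϱ
      rw [hH, hP, ← comp_eq_zero_iff]
      refine and_congr_right fun hϱ => ?_
      rw [← (hβ lam hlam).eq_zero_iff hϱ]
      exact ⟨fun h0 => h0 lam hlam, fun h0 c hc => h.Xi_eq_zero hV hlam hc hϱ h0⟩
    have hsymm : ∀ ϱ : TraceClassSA 𝔥, ϱ.op = P ∘L ϱ.op → ϱ.op = ϱ.op ∘L P :=
      fun ϱ => eq_comp_of_eq_comp hPsa ϱ.2.1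
    have hQl : ∀ T : 𝔥 →L[ℂ] 𝔥, Q ∘L T = 0 ↔ T = P ∘L T := fun T => by
      rw [hQ, ContinuousLinearMap.sub_comp, ContinuousLinearMap.id_comp, sub_eq_zero]
    have hQr : ∀ T : 𝔥 →L[ℂ] 𝔥, T ∘L Q = 0 ↔ T = T ∘L P := fun T => by
      rw [hQ, ContinuousLinearMap.comp_sub, ContinuousLinearMap.comp_id, sub_eq_zero]
    have h1 : H = {ϱ | 0 ≤ ϱ ∧ ϱ.op = P ∘L ϱ.op ∧ ϱ.op = ϱ.op ∘L P} := by
      ext ϱ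
      exact (hmem ϱ).trans
        ⟨fun h0 => ⟨h0.1, h0.2, hsymm ϱ h0.2⟩, fun h0 => ⟨h0.1, h0.2.1⟩⟩
    refine ⟨h1, ?_, ?_⟩
    · simp_rw [hQl, hQr]
      exact h1
    · ext ϱ
      refine ⟨?_, fun h0 => ?_⟩
      · rintro ⟨p, hp, n, hn, rfl⟩
        have e : (p - n).op = P ∘L (p - n).op := by
          rw [TraceClassSA.op_sub, ContinuousLinearMap.comp_sub, ← ((hmem p).1 hp).2,
            ← ((hmem n).1 hn).2]
        exact ⟨e, hsymm _ e⟩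
      · -- the Jordan decomposition stays inside the range of `P`
        obtain ⟨p, n, hp, hn, e, -, hpo, hno⟩ := TraceClassSA.exists_posPart_negPart ϱ
        have hQϱ : Q * ϱ.op = 0 := (hQl ϱ.op).2 h0.1
        refine ⟨p, (hmem p).2 ⟨hp, ?_⟩, n, (hmem n).2 ⟨hn, ?_⟩, e.symm⟩
        · rw [hpo]
          exact (hQl _).1 (mul_posPart_eq_zero ϱ.2.1 hQϱ)
        · rw [hno]
          exact (hQl _).1 (mul_negPart_eq_zero ϱ.2.1 hQϱ)
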